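/- Let \(d\ge 2\) be even, and put \(h(x)=(x,\,x^2-x)\) and \(M_i=4^{i/2}=2^i\) for even \(i\). For even \(N\) and for \(0\le j<N/2\), \(\ell\in\{0,1\}\), let \[ v_{j,\ell}(M,N)=h\!\left(\tfrac{2M(j+\ell)-\ell}{MN-1}\right),\qquad w_{j,\ell}(M,N)=h\!\left(\tfrac{M(2j+1)-(1-\ell)}{MN-1}\right). \] Define polytopes \(Q_i\subseteq\mathbb R^i\) and linear functionals \(\varphi_i,\varphi_i'\) on \(\mathbb R^i\) for even \(i\ge2\) recursively. Let \(Q_2=\operatorname{conv}\{v_{0,\ell}(2,2),\,w_{0,\ell}(2,2):\ell\in\{0,1\}\}\), \(\varphi_2(x)=x_1\), \(\varphi_2'(x)=x_2\), and let \[ Q_{i+2}=\operatorname{conv}\bigl\{\bigl(q,\ v_{j,\ell}(M_i,4)+\varphi_i(q)\,(w_{j,\ell}(M_i,4)-v_{j,\ell}(M_i,4))\bigr): q \text{ a vertex of } Q_i,\ j,\ell\in\{0,1\}\bigr\}, \] \[ \varphi_{i+2}(x)=x_{i+1},\qquad \varphi'_{i+2}(x)=x_{i+2}+\Bigl(\tfrac{M_i-1}{M_{i+2}-1}\Bigr)^2\varphi_i'(x_1,\dots,x_i).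 \] Let \(P=Q_d\), \(M=M_d=2^d\), \(\Pi=(\varphi_d,\varphi_d'):\mathbb R^d\to\mathbb R^2\), \(x^{(t)}=h\!\left(\tfrac{t}{M-1}\right)\), and let \(f:\mathbb R^d\to\mathbb R\) be \(f(x)=y_1^2-c\,y_1-y_2\) where \((y_1,y_2)=\Pi(x)\) and \(c=1-\frac{3}{2M-2}\). The method ActiveSet for maximizing \(f\) over \(\{x: Ax\le b\}\) works as follows. Write \(\mathrm{Eq}(x)=\{i: A_i x=b_i\}\). Start at a feasible point \(x\) with \(\mathcal A=\mathrm{Eq}(x)\). While \(\mathcal D=\{v: A_iv\le 0\ \forall i\in \mathrm{Eq}(x),\ \nabla f(x)^\top v>0\}\) is nonempty: 1. Take \(v\in\mathcal D\) maximizing \(|\{i\in\mathcal A:A_iv=0\}|\). 2. If \(A_iv\ne0\) for some \(i\in\mathcal A\), remove from \(\mathcal A\) some \(i\) with \(A_iv<0\). 3. If now \(A_iv=0\) for all \(i\in\mathcal A\), replace \(x\) by \(x+\mu v\), where \(\mu=\inf\{\mu\ge0: A(x+\mu v)\not\le b\text{ or }\nabla f(x+\mu v)^\top v\le0\}\). If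 \(\nabla f(x)^\top v>0\) still holds at the new \(x\), add some \(j\in\mathrm{Eq}(x)\setminus\mathcal A\) to \(\mathcal A\). A pivot rule is any way of making the choices of \(v\), \(i\) and \(j\). The number of iterations is the number of passes through the loop, counting also the last pass, in which \(\mathcal D=\emptyset\) is found. Equivalently, it is one more than the number of executions of the loop body. **Theorem.** \(P\) is a polytope in \(\mathbb R^d\) with exactly \(2d\) facets and exactly \(2^d\) vertices, it has a description \(P=\{x:Ax\le b\}\) with \(2d\) inequalities and rational data, and \(f\) is convex. For every vertex \(x\) of \(P\) that does not maximize \(f\) over \(P\), there is exactly one edge of \(P\) at \(x\) that is improving, i.e. that contains a point \(y\) with \(\nabla f(x)^\top(y-x)>0\). There is exactly one vertex \(\bar x\) of \(P\) with \(\Pi(\bar x)=x^{(0)}=(0,0)\). For every description \(P=\{x:Ax\le b\}\) by \(m=2d\) inequalities and every pivot rule, ActiveSet started at \(\bar x\) never gets stuck (an admissible choice always exists while \(\mathcal D\neq\emptyset\)) and takes exactly \(2^d=2^{m/2}\) iterations. In doing so it moves along improving edges, visits every vertex of \(P\) exactly once, with the \(t\)-th visited vertex (counting from \(t=0\)) projecting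 to \(x^{(t)}\) for \(t=0,\dots,M-1\), and ends at a maximizer of \(f\) over \(P\). -/

import Mathlib

noncomputable section

/-! ### Polyhedra, vertices, edges, facets

Points of `ℝⁿ` are functions `Fin n → ℝ`; no metric notion is used below except boundedness.
Vertices of a convex set `P` are its extreme points, `P.extremePoints ℝ`. -/

/-- The polyhedron `{x : A x ≤ b}`. -/
def polyhedron {m n : ℕ} (A : Matrix (Fin m) (Fin n) ℝ) (b : Fin m → ℝ) : Set (Fin n → ℝ) :=
  {x | ∀ i, A.mulVec x i ≤ b i}

/-- `F` is a nonempty face of `P`: the set of maximizers over `P` of a linear functional. -/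
def IsFace {n : ℕ} (P F : Set (Fin n → ℝ)) : Prop :=
  F.Nonempty ∧ IsExposed ℝ P F

/-- The dimension of (the affine hull of) a nonempty set. -/
def affDim {n : ℕ} (F : Set (Fin n → ℝ)) : ℕ :=
  Module.finrank ℝ (vectorSpan ℝ F)

/-- A facet is a face of codimension one in `P`. -/
def IsFacet {n : ℕ} (P F : Set (Fin n → ℝ)) : Prop :=
  IsFace P F ∧ affDim F + 1 = affDim P

/-- An edge is a face of dimension one. -/
def IsEdge {n : ℕ} (P F : Set (Fin n → ℝ)) : Prop :=
  IsFace P F ∧ affDim F = 1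

/-- `F` is an edge of `P` incident to the vertex `x` along which `f` increases at `x`
to first order: `∇f(x)ᵀ (y - x) > 0` for a point `y` of `F`. -/
def IsImprovingEdge {n : ℕ} (f : (Fin n → ℝ) → ℝ) (P : Set (Fin n → ℝ)) (x : Fin n → ℝ)
    (F : Set (Fin n → ℝ)) : Prop :=
  IsEdge P F ∧ x ∈ F ∧ ∃ y ∈ F, 0 < fderiv ℝ f x (y - x)

/-! ### The active-set method for `max f(x)` subject to `A x ≤ b` -/

namespace ActiveSet

variable {m n : ℕ}

/-- The memory of the algorithm: the current point and the current active set. -/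
structure State (m n : ℕ) where
  point : Fin n → ℝ
  active : Finset (Fin m)

open Classical in
/-- Indices of the constraints that are active (tight) at `x`. -/
def tight (A : Matrix (Fin m) (Fin n) ℝ) (b : Fin m → ℝ) (x : Fin n → ℝ) : Finset (Fin m) :=
  Finset.univ.filter fun i => A.mulVec x i = b i

/-- The set `𝒟` of feasible improving directions at `x`; `fderiv ℝ f x v` is `∇f(x)ᵀ v`. -/
def improvingDirections (f : (Fin n → ℝ) → ℝ) (A : Matrix (Fin m) (Fin n) ℝ) (b : Fin m → ℝ)
    (x : Fin n → ℝ) : Set (Fin n → ℝ) :=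
  {v | (∀ i ∈ tight A b x, A.mulVec v i ≤ 0) ∧ 0 < fderiv ℝ f x v}

open Classical in
/-- The number of indices `i` in the active set `S` with `A_i v = 0`. -/
def numTight (A : Matrix (Fin m) (Fin n) ℝ) (S : Finset (Fin m)) (v : Fin n → ℝ) : ℕ :=
  (S.filter fun i => A.mulVec v i = 0).card

/-- `A_S v = 0`. -/
def Vanishes (A : Matrix (Fin m) (Fin n) ℝ) (S : Finset (Fin m)) (v : Fin n → ℝ) : Prop :=
  ∀ i ∈ S, A.mulVec v i = 0

/-- First conditional of the loop body: if `A_S v ≠ 0`, remove from `S` some `i` with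
`A_i v < 0`. -/
def DropStep (A : Matrix (Fin m) (Fin n) ℝ) (v : Fin n → ℝ) (S S' : Finset (Fin m)) : Prop :=
  (Vanishes A S v ∧ S' = S) ∨
  (¬ Vanishes A S v ∧ ∃ i ∈ S, A.mulVec v i < 0 ∧ S' = S.erase i)

/-- Second conditional of the loop body: if `A_S v = 0`, move from `x` along `v` until
leaving the polyhedron or until `v` is no longer improving, and if `v` is still improving at
the new point `x'`, add some newly tight constraint `j` to the active set. -/
def MoveStep (f : (Fin n → ℝ) → ℝ) (A : Matrix (Fin m) (Fin n) ℝ) (b : Fin m → ℝ)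
    (v : Fin n → ℝ) (σ σ' : State m n) : Prop :=
  (¬ Vanishes A σ.active v ∧ σ' = σ) ∨
  (Vanishes A σ.active v ∧ ∃ μ : ℝ,
    IsGLB {μ : ℝ | 0 ≤ μ ∧ (σ.point + μ • v ∉ polyhedron A b ∨
      fderiv ℝ f (σ.point + μ • v) v ≤ 0)} μ ∧
    σ'.point = σ.point + μ • v ∧
    ((0 < fderiv ℝ f σ'.point v ∧
        ∃ j ∈ tight A b σ'.point, j ∉ σ.active ∧ σ'.active = insert j σ.active) ∨
     (¬ 0 < fderiv ℝ f σ'.point v ∧ σ'.active = σ.active)))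

/-- One execution of the loop body, for some admissible choice of the direction `v` and of
the leaving and entering indices. A pivot rule is any way of making these choices, so the
executions of the algorithm over all pivot rules are the sequences of such steps. -/
def Step (f : (Fin n → ℝ) → ℝ) (A : Matrix (Fin m) (Fin n) ℝ) (b : Fin m → ℝ)
    (σ σ' : State m n) : Prop :=
  ∃ v ∈ improvingDirections f A b σ.point,
    (∀ v' ∈ improvingDirections f A b σ.point,
      numTight A σ.active v' ≤ numTight A σ.active v) ∧
    ∃ S : Finset (Fin m), DropStep A v σ.active S ∧ MoveStep f A b v ⟨σ.point, S⟩ σ'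

/-- The loop condition fails at `σ`: there is no feasible improving direction. -/
def Halts (f : (Fin n → ℝ) → ℝ) (A : Matrix (Fin m) (Fin n) ℝ) (b : Fin m → ℝ)
    (σ : State m n) : Prop :=
  improvingDirections f A b σ.point = ∅

/-- `s 0, …, s T` is a (possibly unfinished) execution started at the point `x`: the loop body
has been executed `T` times, so the loop condition is being evaluated for the `T + 1`st time. -/
def IsRun (f : (Fin n → ℝ) → ℝ) (A : Matrix (Fin m) (Fin n) ℝ) (b : Fin m → ℝ)
    (x : Fin n → ℝ) (T : ℕ) (s : ℕ → State m n) : Prop :=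
  s 0 = ⟨x, tight A b x⟩ ∧ ∀ t < T, Step f A b (s t) (s (t + 1))

/-- A finished execution. It consists of `T + 1` iterations (passes through the loop), of which
the first `T` execute the loop body and the last one finds the loop condition violated. -/
def IsCompleteRun (f : (Fin n → ℝ) → ℝ) (A : Matrix (Fin m) (Fin n) ℝ) (b : Fin m → ℝ)
    (x : Fin n → ℝ) (T : ℕ) (s : ℕ → State m n) : Prop :=
  IsRun f A b x T s ∧ Halts f A b (s T)

end ActiveSet

/-! ### The extended formulation of the parabola -/

/-- The point `h(x) = (x, x² - x)` of the parabola. -/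
def parabolaPt (x : ℝ) : Fin 2 → ℝ := ![x, x ^ 2 - x]

/-- The vertices `v_{j,ℓ}` of the polygon `V_{M,N}`, for `0 ≤ j < N / 2` and `ℓ ∈ {0, 1}`. -/
def vertV (M N : ℕ) (p : Fin (N / 2) × Fin 2) : Fin 2 → ℝ :=
  let j : ℝ := (p.1 : ℕ)
  let l : ℝ := (p.2 : ℕ)
  parabolaPt ((2 * M * (j + l) - l) / (M * N - 1))

/-- The vertices `w_{j,ℓ}` of the polygon `W_{M,N}`, for `0 ≤ j < N / 2` and `ℓ ∈ {0, 1}`. -/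
def vertW (M N : ℕ) (p : Fin (N / 2) × Fin 2) : Fin 2 → ℝ :=
  let j : ℝ := (p.1 : ℕ)
  let l : ℝ := (p.2 : ℕ)
  parabolaPt ((M * (2 * j + 1) - (1 - l)) / (M * N - 1))

/-- The deformed product `(P, φ) ⋈ (V, W)`, where `V` and `W` are given by their
correspondingly labelled vertices `v` and `w`. -/
def deformedProduct {d r : ℕ} {J : Type} (P : Set (Fin d → ℝ)) (φ : (Fin d → ℝ) → ℝ)
    (v w : J → Fin r → ℝ) : Set (Fin (d + r) → ℝ) :=
  convexHull ℝ {z | ∃ p ∈ P.extremePoints ℝ, ∃ j : J,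
    z = Fin.append p (v j + φ p • (w j - v j))}

/-- `M_i = 4 ^ (i / 2)`, for even `i`. -/
def numVert (i : ℕ) : ℕ := 4 ^ (i / 2)

/-- The second-to-last coordinate `φ_i(x) = x_{i-1}` (coordinates numbered from 1). -/
def phi : (i : ℕ) → (Fin i → ℝ) → ℝ
  | 0, _ => 0
  | 1, _ => 0
  | (i + 2), x => x ⟨i, by omega⟩

/-- The linear functional `φ'_i`, for even `i ≥ 2`: `φ'_2(x) = x_2` and
`φ'_{i+2}(x) = x_{i+2} + ((M_i - 1) / (M_{i+2} - 1))² φ'_i(x_1, …, x_i)`. -/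
def phi' : (i : ℕ) → (Fin i → ℝ) → ℝ
  | 0, _ => 0
  | 1, _ => 0
  | 2, x => x 1
  | (i + 3), x => x (Fin.last (i + 2)) +
      (((numVert (i + 1) : ℝ) - 1) / ((numVert (i + 3) : ℝ) - 1)) ^ 2 *
        phi' (i + 1) (fun j => x (Fin.castAdd 2 j))

/-- The polytope `Q_i ⊆ ℝ^i`, for even `i ≥ 2`: `Q_2` is the convex hull of the vertices of
`V_{2,2}` and `W_{2,2}`, and `Q_{i+2} = (Q_i, φ_i) ⋈ (V_{M_i,4}, W_{M_i,4})`.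
(The values at `i = 0` and odd `i` are irrelevant.) -/
def extPolytope : (i : ℕ) → Set (Fin i → ℝ)
  | 0 => ∅
  | 1 => ∅
  | 2 => convexHull ℝ (Set.range (vertV 2 2) ∪ Set.range (vertW 2 2))
  | (i + 3) => deformedProduct (d := i + 1) (r := 2) (extPolytope (i + 1)) (phi (i + 1))
      (vertV (numVert (i + 1)) 4) (vertW (numVert (i + 1)) 4)

/-- The projection `Π = (φ_d, φ'_d) : ℝ^d → ℝ²`. -/
def shadowProj (d : ℕ) (x : Fin d → ℝ) : Fin 2 → ℝ := ![phi d x, phi' d x]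

/-- The point `x^{(t)} = (t / (M - 1), (t / (M - 1))² - t / (M - 1))` with `M = M_d`. -/
def shadowVertex (d t : ℕ) : Fin 2 → ℝ := parabolaPt ((t : ℝ) / ((numVert d : ℝ) - 1))

/-- The objective `x₁² - c x₁ - x₂` with `c = 1 - 3 / (2M - 2)`, evaluated at
`(x₁, x₂) = Π(x)`. -/
def objective (d : ℕ) (x : Fin d → ℝ) : ℝ :=
  let y := shadowProj d x
  let c : ℝ := 1 - 3 / (2 * (numVert d : ℝ) - 2)
  y 0 ^ 2 - c * y 0 - y 1

end

/-!
The polytope `Q_d` is a *deformed cube*: its `2 d` constraints come in `d` pairs of opposite ones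
that are never tight together, and every choice of one constraint from each pair consists of
linearly independent constraints which meet in a vertex. Indeed, over a point `q` of `Q_i` the
fibre of `Q_{i+2}` is a trapezoid whose edges keep their directions while `φ_i(q)` varies, so the
four new constraints are affine in `(q, x, y)` (`trapezoidSlack`, `DeformedCube.extend`). The face
structure of a deformed cube is that of a cube (`exists_eq_faceSet`, `affDim_faceSet`), which gives
the numbers of vertices and facets; and every description by `2 d` inequalities is, up to order
and positive factors, the system of the facets (`exists_describes`).

Over the vertex of `Q_i` with number `t`, the new vertices have the numbers `t`, `2 M - 1 - t`,
`2 M + t` and `4 M - 1 - t` (`shadow_append`), so the shadows of the vertices of `Q_d` are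
`x^{(0)}, …, x^{(M - 1)}`, each hit once. The derivative of the objective at the `t`-th vertex in
the direction of the `s`-th one is `(s - t) (t - s + 3/2) / (M - 1)²`, which is positive only for
`s = t + 1` (`fderiv_objective_pos_iff`). The cone of feasible directions at a vertex is
generated by the edge directions (`exists_edge_pos`), so the `(t + 1)`-st vertex has to be a
neighbour of the `t`-th one, and the edge between them is the only improving one. No knowledge of
the adjacency of the vertices is needed.

For the active-set method started with all tight constraints active, every improving direction
leaves the constraint that the improving edge leaves; the directions keeping the most active
constraints tight are therefore exactly the positive multiples of this edge direction. By
convexity the objective keeps increasing along the edge, so the method moves to the next vertex,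
and the only constraint it can add is the newly tight one (`Describes.step_iff`). Thus all choices
of the pivot rule are immaterial and the vertices are visited in the order of their shadows.
-/

noncomputable section

open Set Filter Topology

/-! ### Deformed cubes -/

/-- A bounded polyhedron in `ℝᵈ` with the combinatorics of the `d`-cube, given by `d` pairs of
opposite constraints `lin k b x + offset k b ≥ 0`, for `b = false` and `b = true`. Its vertices are
indexed by the sign vectors `σ`, where `σ k` tells which constraint of the `k`-th pair is tight. -/
structure DeformedCube (d : ℕ) where
  /-- the linear part of a constraint -/
  lin : Fin d → Bool → ((Fin d → ℝ) →ₗ[ℝ] ℝ)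
  /-- the constant part of a constraint -/
  offset : Fin d → Bool → ℝ
  /-- the vertex at which the constraints `(k, σ k)` are tight -/
  vert : (Fin d → Bool) → Fin d → ℝ
  /-- The constraints tight at a vertex are linearly independent. -/
  eq_zero_of_lin_eq_zero : ∀ (σ : Fin d → Bool) (v : Fin d → ℝ), (∀ k, lin k (σ k) v = 0) → v = 0
  tight_vert : ∀ σ k, lin k (σ k) (vert σ) + offset k (σ k) = 0
  nonneg_vert : ∀ σ k b, 0 ≤ lin k b (vert σ) + offset k b
  /-- Opposite constraints are never tight at the same point. -/
  opposite_pos : ∀ x, (∀ k b, 0 ≤ lin k b x + offset k b) →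
    ∀ k, 0 < (lin k false x + offset k false) + (lin k true x + offset k true)
  bounded : Bornology.IsBounded {x | ∀ k b, 0 ≤ lin k b x + offset k b}

namespace DeformedCube

variable {d : ℕ} (C : DeformedCube d)

/-- The slack of the constraint `(k, b)` at `x`. -/
def slack (k : Fin d) (b : Bool) (x : Fin d → ℝ) : ℝ := C.lin k b x + C.offset k b

/-- The polyhedron of the points satisfying all constraints. -/
def polytope : Set (Fin d → ℝ) := {x | ∀ k b, 0 ≤ C.slack k b x}

/-- The sign vector `σ` with its `k`-th entry reversed. -/
def flip (σ : Fin d → Bool) (k : Fin d) : Fin d → Bool := Function.update σ k (!σ k)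

@[simp] lemma flip_same (σ : Fin d → Bool) (k : Fin d) : flip σ k k = !σ k := by simp [flip]

lemma flip_of_ne (σ : Fin d → Bool) {j k : Fin d} (h : j ≠ k) : flip σ k j = σ j := by
  simp [flip, h]

lemma flip_injective (σ : Fin d → Bool) : Function.Injective (flip σ) := fun j k h => by
  by_contra hjk
  have := congrFun h j
  rw [flip_same, flip_of_ne σ hjk] at this
  simp at this

lemma slack_add_smul (k : Fin d) (b : Bool) (x v : Fin d → ℝ) (t : ℝ) :
    C.slack k b (x + t • v) = C.slack k b x + t * C.lin k b v := by
  simp only [slack, map_add, map_smul, smul_eq_mul]; ring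

lemma lin_sub (k : Fin d) (b : Bool) (x y : Fin d → ℝ) :
    C.lin k b (x - y) = C.slack k b x - C.slack k b y := by
  simp only [slack, map_sub]; ring

lemma vert_mem (σ : Fin d → Bool) : C.vert σ ∈ C.polytope := fun k b => C.nonneg_vert σ k b

lemma slack_vert (σ : Fin d → Bool) (k : Fin d) : C.slack k (σ k) (C.vert σ) = 0 :=
  C.tight_vert σ k

lemma slack_add_pos {x : Fin d → ℝ} (hx : x ∈ C.polytope) (k : Fin d) (b : Bool) :
    0 < C.slack k b x + C.slack k (!b) x := by
  have h : 0 < C.slack k false x + C.slack k true x := C.opposite_pos x hx k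
  cases b
  · exact h
  · rw [add_comm]; exact h

lemma slack_not_pos {x : Fin d → ℝ} (hx : x ∈ C.polytope) {k : Fin d} {b : Bool}
    (h : C.slack k b x = 0) : 0 < C.slack k (!b) x := by
  simpa [h] using C.slack_add_pos hx k b

lemma slack_vert_pos {σ : Fin d → Bool} {k : Fin d} {b : Bool} (h : b ≠ σ k) :
    0 < C.slack k b (C.vert σ) := by
  have := C.slack_not_pos (C.vert_mem σ) (C.slack_vert σ k)
  rwa [← Bool.eq_not.2 h] at this

lemma slack_vert_eq_zero_iff {σ : Fin d → Bool} {k : Fin d} {b : Bool} :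
    C.slack k b (C.vert σ) = 0 ↔ b = σ k := by
  refine ⟨fun h => ?_, fun h => h ▸ C.slack_vert σ k⟩
  by_contra hb
  exact (C.slack_vert_pos hb).ne' h

lemma vert_injective : Function.Injective C.vert := fun σ τ h => by
  funext k
  exact C.slack_vert_eq_zero_iff.1 (h ▸ C.slack_vert σ k)

/-- The coordinates on `ℝᵈ` given by the linear parts of the constraints tight at `vert σ`. -/
def coord (σ : Fin d → Bool) : (Fin d → ℝ) ≃ₗ[ℝ] (Fin d → ℝ) :=
  LinearEquiv.ofInjectiveEndo (LinearMap.pi fun k => C.lin k (σ k)) <| by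
    rw [← LinearMap.ker_eq_bot, LinearMap.ker_eq_bot']
    exact fun v hv => C.eq_zero_of_lin_eq_zero σ v fun k => congrFun hv k

@[simp] lemma coord_apply (σ : Fin d → Bool) (v : Fin d → ℝ) (k : Fin d) :
    C.coord σ v k = C.lin k (σ k) v := rfl

lemma lin_coord_symm (σ : Fin d → Bool) (c : Fin d → ℝ) (k : Fin d) :
    C.lin k (σ k) ((C.coord σ).symm c) = c k := by
  rw [← coord_apply, LinearEquiv.apply_symm_apply]

lemma ext_lin {σ : Fin d → Bool} {v w : Fin d → ℝ}
    (h : ∀ k, C.lin k (σ k) v = C.lin k (σ k) w) : v = w :=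
  (C.coord σ).injective (funext h)

lemma eq_vert {σ : Fin d → Bool} {x : Fin d → ℝ} (h : ∀ k, C.slack k (σ k) x = 0) :
    x = C.vert σ :=
  sub_eq_zero.1 <| C.eq_zero_of_lin_eq_zero σ _ fun k => by
    rw [lin_sub, h, slack_vert, sub_zero]

/-- A direction that violates no tight constraint is feasible for small steps. -/
lemma eventually_mem {x v : Fin d → ℝ} (hx : x ∈ C.polytope)
    (hv : ∀ k b, C.slack k b x = 0 → 0 ≤ C.lin k b v) :
    ∀ᶠ t : ℝ in 𝓝[>] 0, x + t • v ∈ C.polytope := by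
  have : ∀ k b, ∀ᶠ t : ℝ in 𝓝[>] 0, 0 ≤ C.slack k b (x + t • v) := fun k b => by
    simp only [slack_add_smul]
    rcases (hx k b).eq_or_lt with h | h
    · filter_upwards [self_mem_nhdsWithin] with t ht
      rw [← h, zero_add]
      exact mul_nonneg (le_of_lt ht) (hv k b h.symm)
    · have hc : Tendsto (fun t : ℝ => C.slack k b x + t * C.lin k b v) (𝓝[>] 0)
          (𝓝 (C.slack k b x + 0 * C.lin k b v)) :=
        (Continuous.tendsto (by fun_prop) 0).mono_left nhdsWithin_le_nhds
      rw [zero_mul, add_zero] at hc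
      exact (hc.eventually_const_lt h).mono fun t ht => ht.le
  exact eventually_all.2 fun k => eventually_all.2 fun b => this k b

lemma exists_mem {x v : Fin d → ℝ} (hx : x ∈ C.polytope)
    (hv : ∀ k b, C.slack k b x = 0 → 0 ≤ C.lin k b v) :
    ∃ t : ℝ, 0 < t ∧ x + t • v ∈ C.polytope :=
  ((eventually_mem_nhdsWithin (s := Ioi (0 : ℝ))).and (C.eventually_mem hx hv)).exists

lemma convex_polytope : Convex ℝ C.polytope := by
  intro x hx y hy a b ha hb hab k β
  have : C.slack k β (a • x + b • y) = a * C.slack k β x + b * C.slack k β y := by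
    simp only [slack, map_add, map_smul, smul_eq_mul]
    linear_combination (-C.offset k β) * hab
  rw [this]
  exact add_nonneg (mul_nonneg ha (hx k β)) (mul_nonneg hb (hy k β))

lemma continuous_slack (k : Fin d) (b : Bool) : Continuous (C.slack k b) :=
  (C.lin k b).continuous_of_finiteDimensional.add continuous_const

lemma isCompact_polytope : IsCompact C.polytope := by
  refine Metric.isCompact_of_isClosed_isBounded ?_ C.bounded
  simp only [polytope, ofPred_forall]
  exact isClosed_iInter fun k => isClosed_iInter fun b =>
    isClosed_le continuous_const (C.continuous_slack k b)

theorem extremePoints_polytope : C.polytope.extremePoints ℝ = range C.vert := by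
  ext x
  constructor
  · rintro ⟨hx, hext⟩
    -- if both constraints of some pair are slack at `x`, then `x` can be moved both ways along a
    -- direction that keeps the tight constraints tight
    by_cases h : ∀ k, ∃ b, C.slack k b x = 0
    · choose σ hσ using h
      exact ⟨σ, (C.eq_vert hσ).symm⟩
    · push Not at h
      obtain ⟨k, hk⟩ := h
      obtain ⟨σ, hσ⟩ : ∃ σ : Fin d → Bool, ∀ j b, C.slack j b x = 0 → b = σ j := by
        refine ⟨fun j => decide (C.slack j true x = 0), fun j b hb => ?_⟩
        cases b
        · have := C.slack_not_pos hx hb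
          simpa using this.ne'
        · simpa using hb
      set v := (C.coord σ).symm (Pi.single k 1) with hvdef
      have hv : ∀ j b, C.slack j b x = 0 → C.lin j b v = 0 := fun j b hb => by
        have hjk : j ≠ k := by rintro rfl; exact hk b hb
        rw [hσ j b hb, hvdef, lin_coord_symm, Pi.single_eq_of_ne hjk]
      have h1 := C.eventually_mem (v := v) hx fun j b hb => (hv j b hb).ge
      have h2 := C.eventually_mem (v := -v) hx fun j b hb => by simp [hv j b hb]
      obtain ⟨t, ht, ht1, ht2⟩ :=
        ((eventually_mem_nhdsWithin (s := Ioi (0 : ℝ))).and (h1.and h2)).exists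
      have hmem : x ∈ openSegment ℝ (x + t • v) (x + t • -v) :=
        ⟨1 / 2, 1 / 2, by norm_num, by norm_num, by norm_num, by module⟩
      have h3 := hext ht1 ht2 hmem
      have h4 : t • v = 0 := by simpa using h3
      have h5 : v = 0 := (smul_eq_zero.1 h4).resolve_left (ne_of_gt ht)
      rw [hvdef, LinearEquiv.map_eq_zero_iff] at h5
      simpa using congrFun h5 k
  · rintro ⟨σ, rfl⟩
    refine ⟨C.vert_mem σ, fun y hy z hz hs => ?_⟩
    obtain ⟨a, b, ha, hb, hab, h⟩ := hs
    refine C.eq_vert fun k => ?_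
    have h1 : a * C.slack k (σ k) y + b * C.slack k (σ k) z = 0 := by
      rw [← C.slack_vert σ k, ← h]
      simp only [slack, map_add, map_smul, smul_eq_mul]
      linear_combination (C.offset k (σ k)) * hab
    have h2 := mul_nonneg hb.le (hz k (σ k))
    have h3 := mul_nonneg ha.le (hy k (σ k))
    have h4 : a * C.slack k (σ k) y = 0 := by linarith
    exact (mul_eq_zero.1 h4).resolve_left ha.ne'

theorem convexHull_range_vert : convexHull ℝ (range C.vert) = C.polytope := by
  have h := closure_convexHull_extremePoints C.isCompact_polytope C.convex_polytope
  rw [extremePoints_polytope] at h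
  rwa [(((finite_range C.vert).isCompact_convexHull ℝ).isClosed).closure_eq] at h

lemma ncard_extremePoints : (C.polytope.extremePoints ℝ).ncard = 2 ^ d := by
  rw [extremePoints_polytope, ← image_univ, ncard_image_of_injective _ C.vert_injective,
    ncard_univ]
  simp

end DeformedCube

/-! ### Faces -/

namespace DeformedCube

variable {d : ℕ} (C : DeformedCube d)

/-- The face of the polytope on which the constraints `(k, σ k)` with `k ∈ S` are tight. -/
def faceSet (S : Finset (Fin d)) (σ : Fin d → Bool) : Set (Fin d → ℝ) :=
  {x | x ∈ C.polytope ∧ ∀ k ∈ S, C.slack k (σ k) x = 0}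

lemma vert_mem_faceSet {S : Finset (Fin d)} {σ τ : Fin d → Bool} (h : ∀ k ∈ S, τ k = σ k) :
    C.vert τ ∈ C.faceSet S σ :=
  ⟨C.vert_mem τ, fun k hk => by rw [← h k hk, slack_vert]⟩

/-- There is a point in the relative interior of `faceSet S σ`: only the constraints defining the
face are tight there. -/
lemma exists_relint (S : Finset (Fin d)) (σ : Fin d → Bool) :
    ∃ r ∈ C.faceSet S σ, ∀ k b, 0 < C.slack k b r ∨ (k ∈ S ∧ b = σ k) := by
  classical
  set v := (C.coord σ).symm (fun k => if k ∈ S then 0 else 1) with hvdef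
  have hv : ∀ k, C.lin k (σ k) v = if k ∈ S then 0 else 1 := fun k => by
    rw [hvdef, lin_coord_symm]
  obtain ⟨t, ht, hmem⟩ := C.exists_mem (x := C.vert σ) (v := v) (C.vert_mem σ) fun k b hb => by
    rw [C.slack_vert_eq_zero_iff.1 hb, hv]
    split_ifs <;> norm_num
  have hs : ∀ k, C.slack k (σ k) (C.vert σ + t • v) = if k ∈ S then 0 else t := fun k => by
    rw [slack_add_smul, slack_vert, hv]
    split_ifs <;> simp
  -- halving the step keeps the opposite constraints strictly slack
  refine ⟨C.vert σ + (t / 2) • v, ?_, fun k b => ?_⟩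
  · refine ⟨?_, fun k hk => ?_⟩
    · have := C.convex_polytope (C.vert_mem σ) hmem (a := 1 / 2) (b := 1 / 2)
        (by norm_num) (by norm_num) (by norm_num)
      convert this using 1
      module
    · rw [slack_add_smul, slack_vert, hv, if_pos hk]; simp
  · by_cases hb : b = σ k
    · subst hb
      by_cases hk : k ∈ S
      · exact Or.inr ⟨hk, rfl⟩
      · left
        rw [slack_add_smul, slack_vert, hv, if_neg hk]
        linarith
    · left
      have h1 := C.slack_vert_pos hb
      have h2 := hmem k b
      rw [slack_add_smul] at h2 ⊢
      linarith

lemma mem_vectorSpan_faceSet_of_nonneg {S : Finset (Fin d)} {σ : Fin d → Bool}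
    {v : Fin d → ℝ} (h0 : ∀ k ∈ S, C.lin k (σ k) v = 0) (hv : ∀ k, 0 ≤ C.lin k (σ k) v) :
    v ∈ vectorSpan ℝ (C.faceSet S σ) := by
  obtain ⟨t, ht, hmem⟩ := C.exists_mem (x := C.vert σ) (v := v) (C.vert_mem σ) fun k b hb => by
    rw [C.slack_vert_eq_zero_iff.1 hb]; exact hv k
  have h1 : C.vert σ + t • v ∈ C.faceSet S σ :=
    ⟨hmem, fun k hk => by rw [slack_add_smul, slack_vert, h0 k hk]; simp⟩
  have h2 := vsub_mem_vectorSpan ℝ h1 (C.vert_mem_faceSet (S := S) (τ := σ) fun _ _ => rfl)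
  have h3 := (vectorSpan ℝ (C.faceSet S σ)).smul_mem t⁻¹ h2
  simpa [smul_smul, ht.ne'] using h3

/-- The direction of a face is given by the constraints tight on it. -/
lemma mem_vectorSpan_faceSet {S : Finset (Fin d)} {σ : Fin d → Bool} {v : Fin d → ℝ} :
    v ∈ vectorSpan ℝ (C.faceSet S σ) ↔ ∀ k ∈ S, C.lin k (σ k) v = 0 := by
  constructor
  · intro hv k hk
    have hle : vectorSpan ℝ (C.faceSet S σ) ≤ LinearMap.ker (C.lin k (σ k)) := by
      refine Submodule.span_le.2 ?_
      rintro _ ⟨x, hx, y, hy, rfl⟩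
      change C.lin k (σ k) (x - y) = 0
      rw [lin_sub, hx.2 k hk, hy.2 k hk, sub_zero]
    exact hle hv
  · intro hv
    -- split `v` into its positive and negative part with respect to the coordinates at `vert σ`
    set c := C.coord σ v with hc
    have hck : ∀ k, c k = C.lin k (σ k) v := fun k => rfl
    have hsplit : v = (C.coord σ).symm (fun k => max (c k) 0) -
        (C.coord σ).symm (fun k => max (-c k) 0) := by
      refine C.ext_lin (σ := σ) fun k => ?_
      rw [map_sub, lin_coord_symm, lin_coord_symm, ← hck]
      rcases le_total (c k) 0 with h | h
      · rw [max_eq_right h, max_eq_left (by linarith)]; ring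
      · rw [max_eq_left h, max_eq_right (by linarith)]; ring
    rw [hsplit]
    refine Submodule.sub_mem _ ?_ ?_ <;>
    refine C.mem_vectorSpan_faceSet_of_nonneg (fun k hk => ?_) fun k => ?_
    · rw [lin_coord_symm, hck, hv k hk, max_self]
    · rw [lin_coord_symm]; exact le_max_right _ _
    · rw [lin_coord_symm, hck, hv k hk, neg_zero, max_self]
    · rw [lin_coord_symm]; exact le_max_right _ _

lemma affDim_faceSet (S : Finset (Fin d)) (σ : Fin d → Bool) :
    affDim (C.faceSet S σ) + S.card = d := by
  classical
  set T : (Fin d → ℝ) →ₗ[ℝ] (S → ℝ) := LinearMap.pi fun k : S => C.lin k (σ k) with hT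
  have hker : vectorSpan ℝ (C.faceSet S σ) = LinearMap.ker T := by
    ext v
    rw [mem_vectorSpan_faceSet, LinearMap.mem_ker, funext_iff, Subtype.forall]
    rfl
  have hsurj : Function.Surjective T := fun c => by
    refine ⟨(C.coord σ).symm fun k => if h : k ∈ S then c ⟨k, h⟩ else 0, ?_⟩
    funext k
    change C.lin k (σ k) _ = _
    rw [lin_coord_symm, dif_pos k.2]
  have h := LinearMap.finrank_range_add_finrank_ker T
  rw [LinearMap.range_eq_top.2 hsurj, finrank_top, Module.finrank_fintype_fun_eq_card,
    Module.finrank_fintype_fun_eq_card, Fintype.card_coe, Fintype.card_fin, ← hker] at h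
  rw [affDim]; omega

lemma faceSet_empty (σ : Fin d → Bool) : C.faceSet ∅ σ = C.polytope := by
  ext x; simp [faceSet]

lemma affDim_polytope : affDim C.polytope = d := by
  simpa [faceSet_empty] using C.affDim_faceSet ∅ (fun _ => false)

lemma isFace_faceSet (S : Finset (Fin d)) (σ : Fin d → Bool) :
    IsFace C.polytope (C.faceSet S σ) := by
  refine ⟨⟨_, C.vert_mem_faceSet (τ := σ) fun _ _ => rfl⟩, fun _ => ?_⟩
  set L : (Fin d → ℝ) →ₗ[ℝ] ℝ := -∑ k ∈ S, C.lin k (σ k) with hL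
  have hLx : ∀ x, L x = ∑ k ∈ S, C.offset k (σ k) - ∑ k ∈ S, C.slack k (σ k) x := fun x => by
    simp [hL, slack, Finset.sum_add_distrib]
  refine ⟨LinearMap.toContinuousLinearMap L, ?_⟩
  ext x
  simp only [LinearMap.coe_toContinuousLinearMap', hLx]
  refine and_congr_right fun hx => ⟨fun h y hy => ?_, fun h => ?_⟩
  · rw [Finset.sum_eq_zero h]
    have := Finset.sum_nonneg fun k (_ : k ∈ S) => hy k (σ k)
    linarith
  · have := h _ (C.vert_mem σ)
    rw [Finset.sum_eq_zero (fun k _ => C.slack_vert σ k)] at this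
    exact (Finset.sum_eq_zero_iff_of_nonneg fun k _ => hx k (σ k)).1
      (le_antisymm (by linarith) (Finset.sum_nonneg fun k _ => hx k (σ k)))

/-- Every nonempty face is cut out by the constraints that are tight on all of it. -/
lemma exists_eq_faceSet {F : Set (Fin d → ℝ)} (hF : IsFace C.polytope F) :
    ∃ S σ, F = C.faceSet S σ := by
  classical
  obtain ⟨⟨x₀, hx₀⟩, hexp⟩ := hF
  have hconv : Convex ℝ F := hexp.convex C.convex_polytope
  have hsub : F ⊆ C.polytope := hexp.subset
  -- a point of `F` at which only the constraints tight on all of `F` are tight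
  obtain ⟨r, hr, hrpos⟩ : ∃ r ∈ F, ∀ p : Fin d × Bool,
      (∃ x ∈ F, 0 < C.slack p.1 p.2 x) → 0 < C.slack p.1 p.2 r := by
    suffices h : ∀ K : Finset (Fin d × Bool), ∃ r ∈ F, ∀ p ∈ K,
        (∃ x ∈ F, 0 < C.slack p.1 p.2 x) → 0 < C.slack p.1 p.2 r by
      obtain ⟨r, hr, h⟩ := h Finset.univ
      exact ⟨r, hr, fun p => h p (Finset.mem_univ p)⟩
    intro K
    induction K using Finset.induction_on with
    | empty => exact ⟨x₀, hx₀, by simp⟩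
    | insert q K hq ih =>
      obtain ⟨r, hr, h⟩ := ih
      by_cases hx : ∃ x ∈ F, 0 < C.slack q.1 q.2 x
      · obtain ⟨x, hx, hpos⟩ := hx
        have hmid : ∀ k b, C.slack k b (r + (1 / 2 : ℝ) • (x - r)) =
            C.slack k b r / 2 + C.slack k b x / 2 := fun k b => by
          rw [slack_add_smul, lin_sub]; ring
        refine ⟨r + (1 / 2 : ℝ) • (x - r), ?_, fun p hp hex => ?_⟩
        · convert hconv hr hx (a := 1 / 2) (b := 1 / 2) (by norm_num) (by norm_num)
            (by norm_num) using 1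
          module
        · rw [hmid]
          rcases Finset.mem_insert.1 hp with rfl | hp
          · have := hsub hr p.1 p.2
            linarith
          · have h1 := h p hp hex
            have h2 := hsub hx p.1 p.2
            linarith
      · refine ⟨r, hr, fun p hp hex => ?_⟩
        rcases Finset.mem_insert.1 hp with rfl | hp
        · exact absurd hex hx
        · exact h p hp hex
  have hzero : ∀ k b, C.slack k b r = 0 → ∀ x ∈ F, C.slack k b x = 0 := fun k b h x hx => by
    by_contra hne
    exact (hrpos (k, b) ⟨x, hx, lt_of_le_of_ne (hsub hx k b) (Ne.symm hne)⟩).ne' h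
  refine ⟨Finset.univ.filter fun k => ∃ b, C.slack k b r = 0,
    fun k => decide (C.slack k true r = 0), ?_⟩
  have hσ : ∀ k b, C.slack k b r = 0 → b = decide (C.slack k true r = 0) := fun k b hb => by
    cases b
    · simpa using (C.slack_not_pos (hsub hr) hb).ne'
    · simpa using hb
  ext x
  constructor
  · refine fun hx => ⟨hsub hx, fun k hk => ?_⟩
    obtain ⟨b, hb⟩ := (Finset.mem_filter.1 hk).2
    change C.slack k (decide _) x = 0
    rw [← hσ k b hb]
    exact hzero k b hb x hx
  · rintro ⟨hx, htight⟩
    obtain ⟨l, hl⟩ := hexp ⟨x₀, hx₀⟩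
    -- extending the segment from `x` to `r` beyond `r` stays inside the polytope
    obtain ⟨t, ht, hmem⟩ := C.exists_mem (x := r) (v := r - x) (hsub hr) fun k b hb => by
      rw [lin_sub, hb, hσ k b hb,
        htight k (Finset.mem_filter.2 ⟨Finset.mem_univ k, b, hb⟩), sub_zero]
    rw [hl] at hr ⊢
    refine ⟨hx, fun y hy => (hr.2 y hy).trans ?_⟩
    have h1 := hr.2 _ hmem
    simp only [map_add, map_smul, map_sub, smul_eq_mul] at h1
    by_contra hlt
    have : 0 < t * (l r - l x) := mul_pos ht (by linarith)
    linarith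

/-- The facet on which the constraint `(k, b)` is tight. -/
def facet (p : Fin d × Bool) : Set (Fin d → ℝ) := C.faceSet {p.1} fun _ => p.2

lemma facet_injective : Function.Injective C.facet := by
  intro p q h
  obtain ⟨r, hr, hpos⟩ := C.exists_relint {p.1} fun _ => p.2
  have hq : r ∈ C.facet q := h ▸ hr
  rcases hpos q.1 q.2 with h1 | ⟨h1, h2⟩
  · exact absurd (hq.2 q.1 (by simp)) h1.ne'
  · exact Prod.ext ((Finset.mem_singleton.1 h1).symm) h2.symm

lemma ofPred_isFacet : {F | IsFacet C.polytope F} = range C.facet := by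
  ext F
  simp only [mem_ofPred_eq, mem_range, IsFacet, C.affDim_polytope]
  constructor
  · rintro ⟨hF, hdim⟩
    obtain ⟨S, σ, rfl⟩ := C.exists_eq_faceSet hF
    have := C.affDim_faceSet S σ
    obtain ⟨k, rfl⟩ := Finset.card_eq_one.1 (by omega : S.card = 1)
    exact ⟨(k, σ k), by simp [facet, faceSet]⟩
  · rintro ⟨p, rfl⟩
    exact ⟨C.isFace_faceSet _ _, C.affDim_faceSet {p.1} fun _ => p.2⟩

lemma ncard_facets : {F | IsFacet C.polytope F}.ncard = 2 * d := by
  rw [ofPred_isFacet, ← image_univ, ncard_image_of_injective _ C.facet_injective, ncard_univ]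
  simp [mul_comm]

/-! ### Edges -/

lemma lin_flip_sub (σ : Fin d → Bool) (k : Fin d) :
    0 < C.lin k (σ k) (C.vert (flip σ k) - C.vert σ) := by
  rw [lin_sub, slack_vert, sub_zero]
  exact C.slack_vert_pos (by simp)

lemma lin_flip_sub_of_ne (σ : Fin d → Bool) {j k : Fin d} (h : j ≠ k) :
    C.lin j (σ j) (C.vert (flip σ k) - C.vert σ) = 0 := by
  rw [lin_sub, slack_vert, sub_zero, C.slack_vert_eq_zero_iff, flip_of_ne σ h]

/-- A direction along which all constraints tight at `vert σ` but the `k`-th stay tight is a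
multiple of the edge direction from `vert σ` to `vert (flip σ k)`. -/
lemma eq_smul_of_lin_eq_zero {σ : Fin d → Bool} {k : Fin d} {v : Fin d → ℝ}
    (h : ∀ j, j ≠ k → C.lin j (σ j) v = 0) :
    v = (C.lin k (σ k) v / C.lin k (σ k) (C.vert (flip σ k) - C.vert σ)) •
      (C.vert (flip σ k) - C.vert σ) := by
  refine C.ext_lin (σ := σ) fun j => ?_
  rw [map_smul, smul_eq_mul]
  rcases eq_or_ne j k with rfl | hj
  · rw [div_mul_cancel₀ _ (C.lin_flip_sub σ j).ne']
  · rw [h j hj, C.lin_flip_sub_of_ne σ hj, mul_zero]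

/-- The edges at `vert σ` lead to the vertices whose sign vector differs in one entry. -/
lemma faceSet_erase_eq_segment (σ : Fin d → Bool) (k : Fin d) :
    C.faceSet (Finset.univ.erase k) σ = segment ℝ (C.vert σ) (C.vert (flip σ k)) := by
  apply Subset.antisymm
  · rintro x ⟨hx, ht⟩
    have h := C.eq_smul_of_lin_eq_zero (σ := σ) (k := k) (v := x - C.vert σ) fun j hj => by
      rw [lin_sub, slack_vert, ht j (by simpa using hj), sub_zero]
    set a := C.lin k (σ k) (x - C.vert σ) / C.lin k (σ k) (C.vert (flip σ k) - C.vert σ)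
    rw [segment_eq_image']
    refine ⟨a, ⟨div_nonneg ?_ (C.lin_flip_sub σ k).le, ?_⟩, (sub_eq_iff_eq_add'.1 h).symm⟩
    · rw [lin_sub, slack_vert, sub_zero]; exact hx k (σ k)
    · have h1 : C.slack k (!σ k) x = C.slack k (!σ k) (C.vert σ) * (1 - a) := by
        rw [sub_eq_iff_eq_add'.1 h, slack_add_smul, lin_sub,
          C.slack_vert_eq_zero_iff (σ := flip σ k).2 (flip_same σ k).symm]
        ring
      have h2 := hx k (!σ k)
      rw [h1] at h2
      have := nonneg_of_mul_nonneg_right h2 (C.slack_vert_pos (σ := σ) (k := k) (by simp))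
      linarith
  · have hconv : Convex ℝ (C.faceSet (Finset.univ.erase k) σ) :=
      IsExposed.convex (C.isFace_faceSet _ _).2 C.convex_polytope
    refine hconv.segment_subset (C.vert_mem_faceSet fun _ _ => rfl)
      (C.vert_mem_faceSet fun j hj => flip_of_ne σ (Finset.ne_of_mem_erase hj))

lemma isEdge_segment (σ : Fin d → Bool) (k : Fin d) :
    IsEdge C.polytope (segment ℝ (C.vert σ) (C.vert (flip σ k))) := by
  rw [← faceSet_erase_eq_segment]
  refine ⟨C.isFace_faceSet _ _, ?_⟩
  have := C.affDim_faceSet (Finset.univ.erase k) σ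
  rw [Finset.card_erase_of_mem (Finset.mem_univ k), Finset.card_univ, Fintype.card_fin] at this
  have := k.pos
  omega

lemma exists_eq_segment {F : Set (Fin d → ℝ)} (hF : IsEdge C.polytope F) {σ : Fin d → Bool}
    (hσ : C.vert σ ∈ F) : ∃ k, F = segment ℝ (C.vert σ) (C.vert (flip σ k)) := by
  obtain ⟨hface, hdim⟩ := hF
  obtain ⟨S, τ, rfl⟩ := C.exists_eq_faceSet hface
  have h1 := C.affDim_faceSet S τ
  obtain ⟨k, hk⟩ : ∃ k, Sᶜ = {k} := Finset.card_eq_one.1 <| by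
    rw [Finset.card_compl, Fintype.card_fin]; omega
  have hS : S = Finset.univ.erase k := by
    rw [← compl_compl S, hk]; ext; simp
  refine ⟨k, ?_⟩
  rw [← faceSet_erase_eq_segment, ← hS]
  have hτ : ∀ j ∈ S, τ j = σ j := fun j hj => C.slack_vert_eq_zero_iff.1 (hσ.2 j hj)
  ext x
  refine and_congr_right fun _ => forall₂_congr fun j hj => ?_
  rw [hτ j hj]

/-- The cone of feasible directions at `vert σ` is generated by the edge directions; hence a linear
functional that is positive on a feasible direction `v` is positive on an edge direction occurring
in `v`. -/
lemma exists_edge_pos {σ : Fin d → Bool} {g : (Fin d → ℝ) →ₗ[ℝ] ℝ} {v : Fin d → ℝ}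
    (hv : ∀ k, 0 ≤ C.lin k (σ k) v) (hg : 0 < g v) :
    ∃ k, 0 < C.lin k (σ k) v ∧ 0 < g (C.vert (flip σ k) - C.vert σ) := by
  set a : Fin d → ℝ :=
    fun k => C.lin k (σ k) v / C.lin k (σ k) (C.vert (flip σ k) - C.vert σ) with ha
  have h : v = ∑ k, a k • (C.vert (flip σ k) - C.vert σ) := by
    refine C.ext_lin (σ := σ) fun j => ?_
    rw [map_sum, Finset.sum_eq_single j]
    · rw [map_smul, smul_eq_mul, ha, div_mul_cancel₀ _ (C.lin_flip_sub σ j).ne']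
    · intro k _ hk
      rw [map_smul, C.lin_flip_sub_of_ne σ hk.symm, smul_zero]
    · simp
  rw [h, map_sum] at hg
  obtain ⟨k, -, hk⟩ := Finset.exists_lt_of_sum_lt (f := fun _ => (0 : ℝ)) (by simpa only [Finset.sum_const_zero] using hg)
  rw [map_smul, smul_eq_mul] at hk
  have hak : 0 ≤ a k := div_nonneg (hv k) (C.lin_flip_sub σ k).le
  have hak' : a k ≠ 0 := fun h0 => by simp [h0] at hk
  refine ⟨k, lt_of_le_of_ne (hv k) fun h0 => hak' ?_, pos_of_mul_pos_right hk hak⟩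
  rw [ha]; simp only; rw [← h0, zero_div]

end DeformedCube

namespace DeformedCube

variable {d : ℕ} (C : DeformedCube d)

/-! ### Descriptions with one inequality per facet -/

/-- `A x ≤ b` is, up to the numbering `π` of the rows and positive factors `c`, the system of
the constraints of `C`. -/
structure Describes {m : ℕ} (A : Matrix (Fin m) (Fin d) ℝ) (b : Fin m → ℝ)
    (π : Fin d × Bool ≃ Fin m) (c : Fin d × Bool → ℝ) : Prop where
  pos : ∀ p, 0 < c p
  sub_eq : ∀ p x, b (π p) - A.mulVec x (π p) = c p * C.slack p.1 p.2 x

/-- Every facet-defining constraint occurs, up to a positive factor, among the rows of any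
description. -/
lemma exists_row {m : ℕ} {A : Matrix (Fin m) (Fin d) ℝ} {b : Fin m → ℝ}
    (h : C.polytope = polyhedron A b) (p : Fin d × Bool) :
    ∃ i, ∃ c : ℝ, 0 < c ∧ ∀ x, b i - A.mulVec x i = c * C.slack p.1 p.2 x := by
  classical
  obtain ⟨k, β⟩ := p
  obtain ⟨r, ⟨hr, hr0⟩, hpos⟩ := C.exists_relint {k} fun _ => β
  replace hr0 : C.slack k β r = 0 := hr0 k (by simp)
  have hrA : r ∈ polyhedron A b := h ▸ hr
  obtain ⟨v, hv⟩ : ∃ v, C.lin k β v = -1 :=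
    ⟨(C.coord fun _ => β).symm (fun _ => -1), C.lin_coord_symm (fun _ => β) _ k⟩
  -- some row must stop the point `r` of the facet from moving along the outward direction `v`
  obtain ⟨i, hi, hvi⟩ : ∃ i, A.mulVec r i = b i ∧ 0 < A.mulVec v i := by
    by_contra! hcon
    have hev : ∀ᶠ t : ℝ in 𝓝[>] 0, ∀ i, A.mulVec (r + t • v) i ≤ b i := by
      refine eventually_all.2 fun i => ?_
      simp only [Matrix.mulVec_add, Matrix.mulVec_smul, Pi.add_apply, Pi.smul_apply, smul_eq_mul]
      rcases (hrA i).eq_or_lt with hi | hi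
      · filter_upwards [self_mem_nhdsWithin] with t ht
        have := mul_nonneg (le_of_lt ht) (neg_nonneg.2 (hcon i hi))
        linarith
      · have hc : Tendsto (fun t : ℝ => A.mulVec r i + t * A.mulVec v i) (𝓝[>] 0)
            (𝓝 (A.mulVec r i + 0 * A.mulVec v i)) :=
          (Continuous.tendsto (by fun_prop) 0).mono_left nhdsWithin_le_nhds
        rw [zero_mul, add_zero] at hc
        exact (hc.eventually_lt_const hi).mono fun t ht => ht.le
    obtain ⟨t, ht, hmem⟩ := ((eventually_mem_nhdsWithin (s := Ioi (0 : ℝ))).and hev).exists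
    have hmem' : r + t • v ∈ C.polytope := h ▸ hmem
    have h1 := hmem' k β
    rw [slack_add_smul, hr0, hv] at h1
    have ht' : 0 < t := ht
    linarith
  -- the point `r` can be moved both ways along the facet, so the row is constant on the facet
  have hle : ∀ u, C.lin k β u = 0 → A.mulVec u i ≤ 0 := fun u hu => by
    obtain ⟨t, ht, hmem⟩ := C.exists_mem (x := r) (v := u) hr fun k' b' hb' => by
      rcases hpos k' b' with h1 | ⟨h1, rfl⟩
      · exact absurd hb' h1.ne'
      · rw [Finset.mem_singleton.1 h1, hu]
    have hmem' : r + t • u ∈ polyhedron A b := h ▸ hmem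
    have h1 := hmem' i
    simp only [Matrix.mulVec_add, Matrix.mulVec_smul, Pi.add_apply, Pi.smul_apply, smul_eq_mul,
      hi] at h1
    by_contra! hneg
    have := mul_pos ht hneg
    linarith
  refine ⟨i, A.mulVec v i, hvi, fun x => ?_⟩
  have hu : C.lin k β (x - r + C.slack k β x • v) = 0 := by
    rw [map_add, map_smul, lin_sub, hr0, hv, smul_eq_mul]; ring
  have h1 := hle _ hu
  have h2 := hle (-(x - r + C.slack k β x • v)) (by rw [map_neg, hu, neg_zero])
  simp only [Matrix.mulVec_add, Matrix.mulVec_sub, Matrix.mulVec_smul, Matrix.mulVec_neg,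
    Pi.add_apply, Pi.sub_apply, Pi.neg_apply, Pi.smul_apply, smul_eq_mul, hi] at h1 h2
  linarith

/-- There are as many rows as facets, so a description by `2 d` rows has one row per facet. -/
lemma exists_describes {A : Matrix (Fin (2 * d)) (Fin d) ℝ} {b : Fin (2 * d) → ℝ}
    (h : C.polytope = polyhedron A b) : ∃ π c, C.Describes A b π c := by
  choose π c hc hπ using C.exists_row h
  have hinj : Function.Injective π := fun p q hpq => by
    refine C.facet_injective ?_
    ext x
    refine and_congr_right fun _ => ?_
    have h1 := hπ p x
    rw [hpq, hπ q x] at h1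
    simp only [Finset.mem_singleton, forall_eq]
    constructor <;> intro h0 <;> rw [h0, mul_zero] at h1
    · exact (mul_eq_zero.1 h1).resolve_left (hc q).ne'
    · exact (mul_eq_zero.1 h1.symm).resolve_left (hc p).ne'
  have hbij : Function.Bijective π :=
    (Fintype.bijective_iff_injective_and_card π).2 ⟨hinj, by simp [mul_comm]⟩
  exact ⟨Equiv.ofBijective π hbij, c, hc, hπ⟩

namespace Describes

variable {C} {m : ℕ} {A : Matrix (Fin m) (Fin d) ℝ} {b : Fin m → ℝ}
  {π : Fin d × Bool ≃ Fin m} {c : Fin d × Bool → ℝ}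

lemma mulVec_apply (D : C.Describes A b π c) (p : Fin d × Bool) (v : Fin d → ℝ) :
    A.mulVec v (π p) = -(c p * C.lin p.1 p.2 v) := by
  have h1 := D.sub_eq p v
  have h0 := D.sub_eq p 0
  simp only [Matrix.mulVec_zero, Pi.zero_apply, slack, map_zero] at h0 h1
  linear_combination h0 - h1

lemma mulVec_eq_zero (D : C.Describes A b π c) {p : Fin d × Bool} {v : Fin d → ℝ} :
    A.mulVec v (π p) = 0 ↔ C.lin p.1 p.2 v = 0 := by
  rw [D.mulVec_apply, neg_eq_zero, mul_eq_zero, or_iff_right (D.pos p).ne']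

lemma mulVec_nonpos (D : C.Describes A b π c) {p : Fin d × Bool} {v : Fin d → ℝ} :
    A.mulVec v (π p) ≤ 0 ↔ 0 ≤ C.lin p.1 p.2 v := by
  rw [D.mulVec_apply, neg_nonpos, mul_nonneg_iff_of_pos_left (D.pos p)]

lemma mem_tight (D : C.Describes A b π c) {p : Fin d × Bool} {x : Fin d → ℝ} :
    π p ∈ ActiveSet.tight A b x ↔ C.slack p.1 p.2 x = 0 := by
  simp only [ActiveSet.tight, Finset.mem_filter, Finset.mem_univ, true_and]
  rw [eq_comm, ← sub_eq_zero, D.sub_eq, mul_eq_zero, or_iff_right (D.pos p).ne']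

lemma mem_tight_vert (D : C.Describes A b π c) {p : Fin d × Bool} {σ : Fin d → Bool} :
    π p ∈ ActiveSet.tight A b (C.vert σ) ↔ p.2 = σ p.1 := by
  rw [D.mem_tight, slack_vert_eq_zero_iff]

lemma polyhedron_eq (D : C.Describes A b π c) : polyhedron A b = C.polytope := by
  ext x
  refine ⟨fun h k β => ?_, fun h i => ?_⟩
  · have h1 := sub_nonneg.2 (h (π (k, β)))
    rw [D.sub_eq] at h1
    exact nonneg_of_mul_nonneg_right h1 (D.pos _)
  · obtain ⟨p, rfl⟩ := π.surjective i
    rw [← sub_nonneg, D.sub_eq]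
    exact mul_nonneg (D.pos p).le (h p.1 p.2)

lemma mem_improvingDirections (D : C.Describes A b π c) {f : (Fin d → ℝ) → ℝ}
    {σ : Fin d → Bool} {v : Fin d → ℝ} :
    v ∈ ActiveSet.improvingDirections f A b (C.vert σ) ↔
      (∀ k, 0 ≤ C.lin k (σ k) v) ∧ 0 < fderiv ℝ f (C.vert σ) v := by
  refine and_congr_left fun _ => ⟨fun h k => ?_, fun h i hi => ?_⟩
  · exact D.mulVec_nonpos.1 (h (π (k, σ k)) (D.mem_tight_vert.2 rfl))
  · obtain ⟨⟨k, β⟩, rfl⟩ := π.surjective i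
    obtain rfl : β = σ k := D.mem_tight_vert.1 hi
    exact D.mulVec_nonpos.2 (h k)

end Describes

/-! ### The active-set method at a vertex with a unique improving edge -/

/-- At `vert σ`, the function `f` increases to first order along exactly one edge, namely the one
to `vert (flip σ k)`. -/
def UniqueImproving (f : (Fin d → ℝ) → ℝ) (σ : Fin d → Bool) (k : Fin d) : Prop :=
  ∀ j, 0 < fderiv ℝ f (C.vert σ) (C.vert (flip σ j) - C.vert σ) ↔ j = k

variable {C}

/-- Every improving feasible direction has a positive component along the improving edge. -/
lemma UniqueImproving.lin_pos {f : (Fin d → ℝ) → ℝ} {σ : Fin d → Bool} {k : Fin d}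
    (hk : C.UniqueImproving f σ k) {v : Fin d → ℝ} (hv : ∀ j, 0 ≤ C.lin j (σ j) v)
    (hg : 0 < fderiv ℝ f (C.vert σ) v) : 0 < C.lin k (σ k) v := by
  obtain ⟨j, hj, hgj⟩ := C.exists_edge_pos (g := (fderiv ℝ f (C.vert σ)).toLinearMap) hv hg
  rwa [(hk j).1 hgj] at hj

lemma UniqueImproving.existsUnique {f : (Fin d → ℝ) → ℝ} {σ : Fin d → Bool} {k : Fin d}
    (hk : C.UniqueImproving f σ k) : ∃! F, IsImprovingEdge f C.polytope (C.vert σ) F := by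
  refine ⟨segment ℝ (C.vert σ) (C.vert (flip σ k)), ⟨C.isEdge_segment σ k,
    left_mem_segment ℝ _ _, _, right_mem_segment ℝ _ _, (hk k).2 rfl⟩, ?_⟩
  rintro F ⟨hF, hσ, y, hy, hpos⟩
  obtain ⟨j, rfl⟩ := C.exists_eq_segment hF hσ
  rw [segment_eq_image'] at hy
  obtain ⟨a, ha, rfl⟩ := hy
  rw [add_sub_cancel_left, map_smul, smul_eq_mul] at hpos
  rw [(hk j).1 (pos_of_mul_pos_right hpos ha.1)]

namespace Describes

open ActiveSet

variable {m : ℕ} {A : Matrix (Fin m) (Fin d) ℝ} {b : Fin m → ℝ}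
  {π : Fin d × Bool ≃ Fin m} {c : Fin d × Bool → ℝ}

lemma tight_flip (D : C.Describes A b π c) (σ : Fin d → Bool) (k : Fin d) :
    tight A b (C.vert (flip σ k)) =
      insert (π (k, !σ k)) ((tight A b (C.vert σ)).erase (π (k, σ k))) := by
  ext i
  obtain ⟨⟨j, β⟩, rfl⟩ := π.surjective i
  simp only [Finset.mem_insert, Finset.mem_erase, D.mem_tight_vert, π.injective.eq_iff, ne_eq,
    Prod.mk.injEq]
  rcases eq_or_ne j k with rfl | hj
  · cases β <;> cases h : σ j <;> simp [h]
  · simp [hj, flip_of_ne σ hj]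

/-- The set whose infimum is the step length: moving along a positive multiple of the edge
direction is possible exactly up to the neighbouring vertex. -/
lemma isGLB_stepLength (D : C.Describes A b π c) {f : (Fin d → ℝ) → ℝ} {σ : Fin d → Bool}
    {k : Fin d} {a : ℝ} (ha : 0 < a)
    (hf : ∀ μ : ℝ, 0 ≤ μ → 0 < fderiv ℝ f
      (C.vert σ + μ • a • (C.vert (flip σ k) - C.vert σ))
        (a • (C.vert (flip σ k) - C.vert σ))) :
    IsGLB {μ : ℝ | 0 ≤ μ ∧
      (C.vert σ + μ • a • (C.vert (flip σ k) - C.vert σ) ∉ polyhedron A b ∨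
        fderiv ℝ f (C.vert σ + μ • a • (C.vert (flip σ k) - C.vert σ))
          (a • (C.vert (flip σ k) - C.vert σ)) ≤ 0)} a⁻¹ := by
  have h : {μ : ℝ | 0 ≤ μ ∧
      (C.vert σ + μ • a • (C.vert (flip σ k) - C.vert σ) ∉ polyhedron A b ∨
        fderiv ℝ f (C.vert σ + μ • a • (C.vert (flip σ k) - C.vert σ))
          (a • (C.vert (flip σ k) - C.vert σ)) ≤ 0)} = Ioi a⁻¹ := by
    ext μ
    rw [mem_ofPred_eq, mem_Ioi, D.polyhedron_eq, inv_lt_iff_one_lt_mul₀ ha]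
    constructor
    · rintro ⟨h0, hμ⟩
      by_contra! hle
      refine hμ.elim (fun hmem => hmem ?_) fun hle0 => (hf μ h0).not_ge hle0
      have hseg : C.vert σ + μ • a • (C.vert (flip σ k) - C.vert σ) ∈
          segment ℝ (C.vert σ) (C.vert (flip σ k)) := by
        rw [segment_eq_image']
        exact ⟨μ * a, ⟨mul_nonneg h0 ha.le, by linarith⟩, by simp only [smul_smul]⟩
      exact C.convex_polytope.segment_subset (C.vert_mem _) (C.vert_mem _) hseg
    · intro h1
      have h0 : 0 ≤ μ := (pos_of_mul_pos_left (zero_lt_one.trans h1) ha.le).le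
      refine ⟨h0, Or.inl fun hmem => ?_⟩
      -- beyond the neighbouring vertex, the constraint opposite to `(k, σ k)` is violated
      have h2 := hmem k (!σ k)
      rw [smul_smul, slack_add_smul, lin_sub,
        C.slack_vert_eq_zero_iff (σ := flip σ k).2 (flip_same σ k).symm] at h2
      have h3 : 0 < C.slack k (!σ k) (C.vert σ) := C.slack_vert_pos (by simp)
      nlinarith
  rw [h]
  exact isGLB_Ioi

/-- The method can only move along the improving edge to the next vertex, and the active set is
again the set of all constraints tight there. -/
theorem step_iff (D : C.Describes A b π c) {f : (Fin d → ℝ) → ℝ} {σ : Fin d → Bool}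
    {k : Fin d} (hk : C.UniqueImproving f σ k)
    (hf : ∀ (v : Fin d → ℝ) (μ : ℝ), 0 ≤ μ →
      fderiv ℝ f (C.vert σ) v ≤ fderiv ℝ f (C.vert σ + μ • v) v) (τ : State m d) :
    Step f A b ⟨C.vert σ, tight A b (C.vert σ)⟩ τ ↔
      τ = ⟨C.vert (flip σ k), tight A b (C.vert (flip σ k))⟩ := by
  classical
  set e := C.vert (flip σ k) - C.vert σ with he
  set S := tight A b (C.vert σ) with hS
  have hπ : π (k, σ k) ∈ S := D.mem_tight_vert.2 rfl
  have hπ' : π (k, !σ k) ∉ S := fun h => by simpa using D.mem_tight_vert.1 h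
  have he_mem : e ∈ improvingDirections f A b (C.vert σ) := by
    refine D.mem_improvingDirections.2 ⟨fun j => ?_, (hk k).2 rfl⟩
    rcases eq_or_ne j k with rfl | hj
    · exact (C.lin_flip_sub σ j).le
    · exact (C.lin_flip_sub_of_ne σ hj).ge
  have he_vanish : ∀ i ∈ S.erase (π (k, σ k)), A.mulVec e i = 0 := fun i hi => by
    obtain ⟨⟨j, β⟩, rfl⟩ := π.surjective i
    obtain ⟨hne, hi⟩ := Finset.mem_erase.1 hi
    obtain rfl : β = σ j := D.mem_tight_vert.1 hi
    exact D.mulVec_eq_zero.2 (C.lin_flip_sub_of_ne σ fun hj => hne (by rw [show j = k from hj]))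
  have hfilter : S.filter (fun i => A.mulVec e i = 0) = S.erase (π (k, σ k)) := by
    ext i
    simp only [Finset.mem_filter, Finset.mem_erase]
    refine ⟨fun ⟨h1, h2⟩ => ⟨?_, h1⟩, fun h => ⟨h.2, he_vanish i (Finset.mem_erase.2 h)⟩⟩
    rintro rfl
    exact (C.lin_flip_sub σ k).ne' (D.mulVec_eq_zero.1 h2)
  -- the constraint `(k, σ k)` is left by every improving direction
  have hsub : ∀ v ∈ improvingDirections f A b (C.vert σ),
      S.filter (fun i => A.mulVec v i = 0) ⊆ S.erase (π (k, σ k)) := fun v hv i hi => by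
    obtain ⟨h1, h2⟩ := Finset.mem_filter.1 hi
    refine Finset.mem_erase.2 ⟨?_, h1⟩
    rintro rfl
    obtain ⟨h3, h4⟩ := D.mem_improvingDirections.1 hv
    exact (hk.lin_pos h3 h4).ne' (D.mulVec_eq_zero.1 h2)
  -- along a multiple of the edge direction, the second half of the loop body is deterministic
  have hmove : ∀ a : ℝ, 0 < a → (MoveStep f A b (a • e) ⟨C.vert σ, S.erase (π (k, σ k))⟩ τ ↔
      τ = ⟨C.vert (flip σ k), tight A b (C.vert (flip σ k))⟩) := fun a ha => by
    have hpos : 0 < fderiv ℝ f (C.vert σ) (a • e) := by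
      rw [map_smul, smul_eq_mul]; exact mul_pos ha he_mem.2
    have hgrad : ∀ μ : ℝ, 0 ≤ μ → 0 < fderiv ℝ f (C.vert σ + μ • a • e) (a • e) :=
      fun μ hμ => hpos.trans_le (hf _ μ hμ)
    have hvan : Vanishes A (S.erase (π (k, σ k))) (a • e) := fun i hi => by
      rw [Matrix.mulVec_smul, Pi.smul_apply, he_vanish i hi, smul_zero]
    have hglb := D.isGLB_stepLength ha hgrad
    have hend : C.vert σ + a⁻¹ • a • e = C.vert (flip σ k) := by
      rw [smul_smul, inv_mul_cancel₀ ha.ne', one_smul, he, add_sub_cancel]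
    have hgend := hgrad a⁻¹ (inv_pos.2 ha).le
    rw [hend] at hgend
    constructor
    · rintro (⟨h, -⟩ | ⟨-, μ, hμ, hpt, hact⟩)
      · exact absurd hvan h
      · obtain ⟨x', S'⟩ := τ
        obtain rfl : μ = a⁻¹ := hμ.unique hglb
        obtain rfl : x' = C.vert (flip σ k) := hpt.trans hend
        rcases hact with ⟨-, j, hj, hjS, rfl⟩ | ⟨h, -⟩
        · simp only at hj hjS ⊢
          rw [D.tight_flip, Finset.mem_insert] at hj
          rw [D.tight_flip, hj.resolve_right hjS]
        · exact absurd hgend h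
    · rintro rfl
      refine Or.inr ⟨hvan, a⁻¹, hglb, hend.symm, Or.inl ⟨hgend, π (k, !σ k), ?_, ?_, ?_⟩⟩
      · exact D.mem_tight_vert.2 (flip_same σ k).symm
      · exact fun h => hπ' (Finset.mem_of_mem_erase h)
      · exact D.tight_flip σ k
  constructor
  · rintro ⟨v, hv, hmax, S', hdrop, hτ⟩
    have hv' := D.mem_improvingDirections.1 hv
    have hvk := hk.lin_pos hv'.1 hv'.2
    -- by maximality, `v` keeps as many active constraints tight as the edge direction does
    have heq : S.filter (fun i => A.mulVec v i = 0) = S.erase (π (k, σ k)) :=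
      Finset.eq_of_subset_of_card_le (hsub v hv) (hfilter ▸ hmax e he_mem)
    have hvan : ∀ i ∈ S.erase (π (k, σ k)), A.mulVec v i = 0 := fun i hi =>
      (Finset.mem_filter.1 (heq.ge hi)).2
    have hva := C.eq_smul_of_lin_eq_zero (σ := σ) (k := k) (v := v) fun j hj =>
      D.mulVec_eq_zero.1 (hvan (π (j, σ j)) (Finset.mem_erase.2
        ⟨fun h => hj (Prod.mk.inj (π.injective h)).1, D.mem_tight_vert.2 rfl⟩))
    have hS' : S' = S.erase (π (k, σ k)) := by
      rcases hdrop with ⟨h, -⟩ | ⟨-, i, hi, hneg, rfl⟩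
      · exact absurd (D.mulVec_eq_zero.1 (h _ hπ)) hvk.ne'
      · simp only at hi ⊢
        by_cases hik : i = π (k, σ k)
        · rw [hik]
        · exact absurd (hvan i (Finset.mem_erase.2 ⟨hik, hi⟩)) hneg.ne
    rw [hva, hS'] at hτ
    exact (hmove _ (div_pos hvk (C.lin_flip_sub σ k))).1 hτ
  · intro hτ
    refine ⟨e, he_mem, fun v hv => ?_, S.erase (π (k, σ k)), Or.inr ⟨fun h => ?_, π (k, σ k), hπ,
      ?_, rfl⟩, by simpa using (hmove 1 one_pos).2 hτ⟩
    · exact Finset.card_le_card ((hsub v hv).trans hfilter.ge)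
    · exact (C.lin_flip_sub σ k).ne' (D.mulVec_eq_zero.1 (h _ hπ))
    · rw [D.mulVec_apply, neg_lt_zero]
      exact mul_pos (D.pos _) (C.lin_flip_sub σ k)

lemma halts (D : C.Describes A b π c) {f : (Fin d → ℝ) → ℝ} {σ : Fin d → Bool}
    (h : ∀ j, fderiv ℝ f (C.vert σ) (C.vert (flip σ j) - C.vert σ) ≤ 0)
    (S : Finset (Fin m)) : Halts f A b ⟨C.vert σ, S⟩ := by
  refine eq_empty_of_forall_notMem fun v hv => ?_
  obtain ⟨h1, h2⟩ := D.mem_improvingDirections.1 hv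
  obtain ⟨j, -, hj⟩ := C.exists_edge_pos (g := (fderiv ℝ f (C.vert σ)).toLinearMap) h1 h2
  exact (h j).not_gt hj

end Describes
end DeformedCube

/-! ### The deformed product with the trapezoids -/

/-- The vertex of the trapezoid over a point at which the deforming functional takes the value
`a`, labelled as the vertices of `V_{M,4}` and `W_{M,4}`. -/
def corner (M : ℕ) (p : Fin (4 / 2) × Fin 2) (a : ℝ) : Fin 2 → ℝ :=
  vertV M 4 p + a • (vertW M 4 p - vertV M 4 p)

/-- The label of the corner of the trapezoid on the right (`h = true`) or left (`h = false`) and on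
the top (`v = true`) or bottom (`v = false`). -/
def cornerLabel (h v : Bool) : Fin (4 / 2) × Fin 2 :=
  (cond h 1 0, cond (h == v) 1 0)

lemma exists_cornerLabel : ∀ p, ∃ h v, cornerLabel h v = p := by decide

/-- `4 M - 1` times the first coordinate of a corner, where `s = (M - 1) a`. -/
def cornerX (M s : ℝ) : Bool → Bool → ℝ
  | false, true => s
  | false, false => 2 * M - 1 - s
  | true, false => 2 * M + s
  | true, true => 4 * M - 1 - s

/-- `(4 M - 1)²` times the second coordinate of a corner, where `s = (M - 1) a`. -/
def cornerY (M s : ℝ) : Bool → ℝ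
  | true => -(3 * M * s)
  | false => M * s - 2 * M * (2 * M - 1)

lemma mul_corner_zero {M : ℕ} (hM : 1 ≤ M) (a : ℝ) (h v : Bool) :
    (4 * M - 1) * corner M (cornerLabel h v) a 0 = cornerX M ((M - 1) * a) h v := by
  have hM' : (1 : ℝ) ≤ M := by exact_mod_cast hM
  have hD : (M : ℝ) * 4 - 1 ≠ 0 := by linarith
  have hD' : 4 * (M : ℝ) - 1 ≠ 0 := by linarith
  cases h <;> cases v <;>
    simp [corner, cornerLabel, vertV, vertW, parabolaPt, cornerX] <;> field_simp <;> ring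

lemma mul_corner_one {M : ℕ} (hM : 1 ≤ M) (a : ℝ) (h v : Bool) :
    (4 * M - 1) ^ 2 * corner M (cornerLabel h v) a 1 = cornerY M ((M - 1) * a) v := by
  have hM' : (1 : ℝ) ≤ M := by exact_mod_cast hM
  have hD : (M : ℝ) * 4 - 1 ≠ 0 := by linarith
  have hD' : 4 * (M : ℝ) - 1 ≠ 0 := by linarith
  cases h <;> cases v <;>
    simp [corner, cornerLabel, vertV, vertW, parabolaPt, cornerY] <;> field_simp <;> ring

/-- The slacks of the four edges of the trapezoid, multiplied by `(4 M - 1)²`, where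
`s = (M - 1) a` and `a` is the value of the deforming functional. Index `0` stands for the left and right, index `1` for the
bottom and top edge (`false` and `true`, respectively). -/
def trapezoidSlack (M s x y : ℝ) : Fin 2 → Bool → ℝ :=
  ![fun b => cond b ((4 * M - 1) ^ 2 * y + 2 * M * (4 * M - 1) * (1 - x) + M * s)
      ((4 * M - 1) ^ 2 * y + 2 * M * (4 * M - 1) * x + M * s),
    fun b => cond b (-((4 * M - 1) ^ 2 * y) - 3 * M * s)
      ((4 * M - 1) ^ 2 * y + 2 * M * (2 * M - 1) - M * s)]

/-- `trapezoidSlack` as a function of `X = (4 M - 1) x` and `Y = (4 M - 1)² y`. -/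
lemma trapezoidSlack_eq {M s x y X Y : ℝ} (hX : (4 * M - 1) * x = X)
    (hY : (4 * M - 1) ^ 2 * y = Y) :
    trapezoidSlack M s x y =
      ![fun b => cond b (Y + 2 * M * (4 * M - 1 - X) + M * s) (Y + 2 * M * X + M * s),
        fun b => cond b (-Y - 3 * M * s) (Y + 2 * M * (2 * M - 1) - M * s)] := by
  subst hX hY
  funext j b
  fin_cases j <;> cases b <;> simp [trapezoidSlack] <;> ring

lemma trapezoidSlack_corner {M : ℕ} (hM : 1 ≤ M) (a : ℝ) (σ : Fin 2 → Bool) (j : Fin 2) :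
    trapezoidSlack M ((M - 1) * a) (corner M (cornerLabel (σ 0) (σ 1)) a 0)
      (corner M (cornerLabel (σ 0) (σ 1)) a 1) j (σ j) = 0 := by
  rw [trapezoidSlack_eq (mul_corner_zero hM a (σ 0) (σ 1)) (mul_corner_one hM a (σ 0) (σ 1))]
  fin_cases j <;> cases h : σ 0 <;> cases h' : σ 1 <;> simp [cornerX, cornerY, h, h'] <;> ring

lemma trapezoidSlack_corner_nonneg {M : ℕ} (hM : 1 ≤ M) {a : ℝ} (h0 : 0 ≤ a) (h1 : a ≤ 1)
    (h v : Bool) (j : Fin 2) (b : Bool) :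
    0 ≤ trapezoidSlack M ((M - 1) * a) (corner M (cornerLabel h v) a 0)
      (corner M (cornerLabel h v) a 1) j b := by
  have hM' : (1 : ℝ) ≤ M := by exact_mod_cast hM
  rw [trapezoidSlack_eq (mul_corner_zero hM a h v) (mul_corner_one hM a h v)]
  have hs : 0 ≤ (M - 1) * a := mul_nonneg (by linarith) h0
  have hs' : 0 ≤ M * ((M - 1) - (M - 1) * a) := by
    rw [← mul_one_sub]
    exact mul_nonneg (by linarith) (mul_nonneg (by linarith) (by linarith))
  have hMs : 0 ≤ M * ((M - 1) * a) := mul_nonneg (by linarith) hs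
  have hMM : 0 ≤ (M : ℝ) * (M - 1) := mul_nonneg (by linarith) (by linarith)
  generalize (M - 1) * a = s at *
  fin_cases j <;> cases h <;> cases v <;> cases b <;> simp [cornerX, cornerY] <;> nlinarith

/-- Opposite edges of the trapezoid are disjoint. -/
lemma trapezoidSlack_add_pos {M a x y : ℝ} (hM : 1 ≤ M) (h0 : 0 ≤ a) (h1 : a ≤ 1)
    (h : ∀ j b, 0 ≤ trapezoidSlack M ((M - 1) * a) x y j b) (j : Fin 2) :
    0 < trapezoidSlack M ((M - 1) * a) x y j false +
      trapezoidSlack M ((M - 1) * a) x y j true := by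
  have hs : 0 ≤ M * ((M - 1) * a) := mul_nonneg (by linarith) (mul_nonneg (by linarith) h0)
  have hs' : 0 ≤ M * ((M - 1) - (M - 1) * a) := by
    rw [← mul_one_sub]
    exact mul_nonneg (by linarith) (mul_nonneg (by linarith) (by linarith))
  have hbot := h 1 false
  rw [trapezoidSlack_eq rfl rfl] at hbot ⊢
  generalize (M - 1) * a = s at *
  fin_cases j <;> simp at hbot ⊢ <;> nlinarith

lemma abs_le_one_of_trapezoidSlack {M a x y : ℝ} (hM : 1 ≤ M) (h0 : 0 ≤ a) (h1 : a ≤ 1)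
    (h : ∀ j b, 0 ≤ trapezoidSlack M ((M - 1) * a) x y j b) : |x| ≤ 1 ∧ |y| ≤ 1 := by
  have hs : 0 ≤ M * ((M - 1) * a) := mul_nonneg (by linarith) (mul_nonneg (by linarith) h0)
  have hs' : 0 ≤ M * ((M - 1) - (M - 1) * a) := by
    rw [← mul_one_sub]
    exact mul_nonneg (by linarith) (mul_nonneg (by linarith) (by linarith))
  have hl := h 0 false
  have hr := h 0 true
  have hb := h 1 false
  have ht := h 1 true
  clear h
  generalize (M - 1) * a = s at *
  simp only [trapezoidSlack, Matrix.cons_val_zero, Matrix.cons_val_one, cond_true,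
    cond_false] at hl hr hb ht
  have hpos : 0 < 2 * M * (4 * M - 1) := by nlinarith
  have hx0 : 0 ≤ x := nonneg_of_mul_nonneg_right (a := 2 * M * (4 * M - 1)) (by linarith) hpos
  have hx1 : 0 ≤ 1 - x := nonneg_of_mul_nonneg_right (a := 2 * M * (4 * M - 1)) (by linarith) hpos
  have hD : 0 < (4 * M - 1) ^ 2 := by nlinarith
  have hy0 : 0 ≤ -y := nonneg_of_mul_nonneg_right (a := (4 * M - 1) ^ 2) (by linarith) hD
  have hy1 : 0 ≤ 1 + y := nonneg_of_mul_nonneg_right (a := (4 * M - 1) ^ 2) (by nlinarith) hD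
  exact ⟨abs_le.2 ⟨by linarith, by linarith⟩, abs_le.2 ⟨by linarith, by linarith⟩⟩

namespace DeformedCube

variable {d : ℕ}

/-- The projection `ℝ^{d+2} → ℝ^d` onto the first `d` coordinates. -/
def initial (d : ℕ) : (Fin (d + 2) → ℝ) →ₗ[ℝ] (Fin d → ℝ) :=
  LinearMap.funLeft ℝ ℝ (Fin.castAdd 2)

lemma initial_apply (x : Fin (d + 2) → ℝ) (k : Fin d) : initial d x k = x (Fin.castAdd 2 k) := rfl

@[simp] lemma initial_append (p : Fin d → ℝ) (z : Fin 2 → ℝ) : initial d (Fin.append p z) = p :=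
  funext fun k => Fin.append_left p z k

/-- The linear part of `trapezoidSlack M ((M - 1) φ(q)) x y` as a functional of `(q, x, y)`. -/
def trapezoidLin (M : ℝ) (φ : (Fin d → ℝ) →ₗ[ℝ] ℝ) :
    Fin 2 → Bool → ((Fin (d + 2) → ℝ) →ₗ[ℝ] ℝ) :=
  let X : (Fin (d + 2) → ℝ) →ₗ[ℝ] ℝ := LinearMap.proj (Fin.natAdd d 0)
  let Y : (Fin (d + 2) → ℝ) →ₗ[ℝ] ℝ := LinearMap.proj (Fin.natAdd d 1)
  let a : (Fin (d + 2) → ℝ) →ₗ[ℝ] ℝ := φ ∘ₗ initial d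
  ![fun b => cond b
      ((4 * M - 1) ^ 2 • Y - (2 * M * (4 * M - 1)) • X + (M * (M - 1)) • a)
      ((4 * M - 1) ^ 2 • Y + (2 * M * (4 * M - 1)) • X + (M * (M - 1)) • a),
    fun b => cond b (-(4 * M - 1) ^ 2 • Y - (3 * M * (M - 1)) • a)
      ((4 * M - 1) ^ 2 • Y - (M * (M - 1)) • a)]

/-- The constant part of `trapezoidSlack`. -/
def trapezoidOffset (M : ℝ) : Fin 2 → Bool → ℝ :=
  ![fun b => cond b (2 * M * (4 * M - 1)) 0, fun b => cond b 0 (2 * M * (2 * M - 1))]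

lemma trapezoidLin_add_offset (M : ℝ) (φ : (Fin d → ℝ) →ₗ[ℝ] ℝ) (x : Fin (d + 2) → ℝ)
    (j : Fin 2) (b : Bool) : trapezoidLin M φ j b x + trapezoidOffset M j b =
      trapezoidSlack M ((M - 1) * φ (initial d x)) (x (Fin.natAdd d 0)) (x (Fin.natAdd d 1))
        j b := by
  fin_cases j <;> cases b <;>
    simp [trapezoidLin, trapezoidOffset, trapezoidSlack] <;> ring

lemma trapezoidLin_eq_zero {M : ℝ} (hM : 1 ≤ M) {φ : (Fin d → ℝ) →ₗ[ℝ] ℝ}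
    {v : Fin (d + 2) → ℝ} (h0 : initial d v = 0) {σ : Fin 2 → Bool}
    (h : ∀ j, trapezoidLin M φ j (σ j) v = 0) :
    v (Fin.natAdd d 0) = 0 ∧ v (Fin.natAdd d 1) = 0 := by
  have hx := h 0
  have hy := h 1
  have hD : 4 * M - 1 ≠ 0 := by linarith
  have hM0 : M ≠ 0 := by linarith
  have hy0 : v (Fin.natAdd d 1) = 0 := by
    cases h1 : σ 1 <;> simpa [trapezoidLin, h0, h1, hD] using hy
  refine ⟨?_, hy0⟩
  cases h1 : σ 0 <;>
    simpa [trapezoidLin, h0, h1, hD, hM0, -Fin.natAdd_zero, hy0] using hx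

/-- The deformed product of a deformed cube with the trapezoids `V_{M,4}`, `W_{M,4}`. -/
def extend (C : DeformedCube d) (M : ℕ) (hM : 1 ≤ M) (φ : (Fin d → ℝ) →ₗ[ℝ] ℝ)
    (hφ : ∀ x ∈ C.polytope, 0 ≤ φ x ∧ φ x ≤ 1) : DeformedCube (d + 2) where
  lin := Fin.addCases (fun k b => C.lin k b ∘ₗ initial d) (trapezoidLin M φ)
  offset := Fin.addCases C.offset (trapezoidOffset M)
  vert σ := Fin.append (C.vert fun k => σ (Fin.castAdd 2 k))
    (corner M (cornerLabel (σ (Fin.natAdd d 0)) (σ (Fin.natAdd d 1)))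
      (φ (C.vert fun k => σ (Fin.castAdd 2 k))))
  eq_zero_of_lin_eq_zero σ v h := by
    have h0 : initial d v = 0 := C.eq_zero_of_lin_eq_zero (fun k => σ (Fin.castAdd 2 k)) _
      fun k => by simpa using h (Fin.castAdd 2 k)
    obtain ⟨hx, hy⟩ := trapezoidLin_eq_zero (M := M) (by exact_mod_cast hM) (φ := φ) h0
      (σ := fun j => σ (Fin.natAdd d j)) fun j => by simpa using h (Fin.natAdd d j)
    funext k
    refine Fin.addCases (fun k => congrFun h0 k) (fun j => ?_) k
    fin_cases j
    · exact hx
    · exact hy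
  tight_vert σ k := by
    refine Fin.addCases (fun k => ?_) (fun j => ?_) k
    · simpa using C.tight_vert (fun k => σ (Fin.castAdd 2 k)) k
    · simp only [Fin.addCases_right, trapezoidLin_add_offset, initial_append, Fin.append_right]
      exact trapezoidSlack_corner hM _ (fun j => σ (Fin.natAdd d j)) j
  nonneg_vert σ k b := by
    refine Fin.addCases (fun k => ?_) (fun j => ?_) k
    · simpa using C.nonneg_vert _ k b
    · simp only [Fin.addCases_right, trapezoidLin_add_offset, initial_append, Fin.append_right]
      have h := hφ _ (C.vert_mem fun k => σ (Fin.castAdd 2 k))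
      exact trapezoidSlack_corner_nonneg hM h.1 h.2 _ _ j b
  opposite_pos x h k := by
    have h0 : initial d x ∈ C.polytope := fun k b => by
      simpa [slack] using h (Fin.castAdd 2 k) b
    refine Fin.addCases (fun k => ?_) (fun j => ?_) k
    · simpa using C.opposite_pos _ h0 k
    · simp only [Fin.addCases_right, trapezoidLin_add_offset]
      refine trapezoidSlack_add_pos (by exact_mod_cast hM) (hφ _ h0).1 (hφ _ h0).2
        (fun j b => ?_) j
      simpa only [Fin.addCases_right, trapezoidLin_add_offset] using h (Fin.natAdd d j) b
  bounded := by
    obtain ⟨R, hR⟩ := isBounded_iff_forall_norm_le.1 C.bounded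
    refine isBounded_iff_forall_norm_le.2 ⟨max R 1, fun x h => ?_⟩
    have h0 : initial d x ∈ C.polytope := fun k b => by
      simpa [slack] using h (Fin.castAdd 2 k) b
    obtain ⟨hx, hy⟩ := abs_le_one_of_trapezoidSlack (M := M) (by exact_mod_cast hM) (hφ _ h0).1
      (hφ _ h0).2 (fun j b => by
        simpa only [Fin.addCases_right, trapezoidLin_add_offset] using h (Fin.natAdd d j) b)
    refine (pi_norm_le_iff_of_nonneg (le_max_of_le_right zero_le_one)).2 fun k => ?_
    refine Fin.addCases (fun k => ?_) (fun j => ?_) k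
    · exact le_max_of_le_left ((norm_le_pi_norm (initial d x) k).trans (hR _ h0))
    · refine le_max_of_le_right ?_
      fin_cases j
      · exact hx
      · exact hy

lemma slack_extend_castAdd (C : DeformedCube d) {M : ℕ} (hM : 1 ≤ M) {φ : (Fin d → ℝ) →ₗ[ℝ] ℝ}
    (hφ : ∀ x ∈ C.polytope, 0 ≤ φ x ∧ φ x ≤ 1) (k : Fin d) (b : Bool) (x : Fin (d + 2) → ℝ) :
    (C.extend M hM φ hφ).slack (Fin.castAdd 2 k) b x = C.slack k b (initial d x) := by
  simp [slack, extend]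

lemma slack_extend_natAdd (C : DeformedCube d) {M : ℕ} (hM : 1 ≤ M) {φ : (Fin d → ℝ) →ₗ[ℝ] ℝ}
    (hφ : ∀ x ∈ C.polytope, 0 ≤ φ x ∧ φ x ≤ 1) (j : Fin 2) (b : Bool) (x : Fin (d + 2) → ℝ) :
    (C.extend M hM φ hφ).slack (Fin.natAdd d j) b x =
      trapezoidSlack M ((M - 1) * φ (initial d x)) (x (Fin.natAdd d 0)) (x (Fin.natAdd d 1))
        j b := by
  rw [← trapezoidLin_add_offset]
  simp [slack, extend]

lemma vert_extend (C : DeformedCube d) {M : ℕ} (hM : 1 ≤ M) {φ : (Fin d → ℝ) →ₗ[ℝ] ℝ}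
    (hφ : ∀ x ∈ C.polytope, 0 ≤ φ x ∧ φ x ≤ 1) (σ : Fin d → Bool) (τ : Fin 2 → Bool) :
    (C.extend M hM φ hφ).vert (Fin.append σ τ) =
      Fin.append (C.vert σ) (corner M (cornerLabel (τ 0) (τ 1)) (φ (C.vert σ))) := by
  simp [extend]

lemma range_vert_extend (C : DeformedCube d) {M : ℕ} (hM : 1 ≤ M) {φ : (Fin d → ℝ) →ₗ[ℝ] ℝ}
    (hφ : ∀ x ∈ C.polytope, 0 ≤ φ x ∧ φ x ≤ 1) :
    range (C.extend M hM φ hφ).vert =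
      {z | ∃ σ p, z = Fin.append (C.vert σ) (corner M p (φ (C.vert σ)))} := by
  ext z
  constructor
  · rintro ⟨σ, rfl⟩
    exact ⟨_, _, rfl⟩
  · rintro ⟨σ, p, rfl⟩
    obtain ⟨h, v, rfl⟩ := exists_cornerLabel p
    exact ⟨Fin.append σ ![h, v], C.vert_extend hM hφ σ _⟩

theorem polytope_extend (C : DeformedCube d) {M : ℕ} (hM : 1 ≤ M) {φ : (Fin d → ℝ) →ₗ[ℝ] ℝ}
    (hφ : ∀ x ∈ C.polytope, 0 ≤ φ x ∧ φ x ≤ 1) :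
    (C.extend M hM φ hφ).polytope = deformedProduct C.polytope φ (vertV M 4) (vertW M 4) := by
  rw [← convexHull_range_vert, range_vert_extend, deformedProduct, extremePoints_polytope]
  congr 1
  ext z
  simp [corner]

/-- The point `ℝ⁰`, from which the polytopes are built. -/
def point : DeformedCube 0 where
  lin k := k.elim0
  offset k := k.elim0
  vert _ := ![]
  eq_zero_of_lin_eq_zero _ _ _ := Subsingleton.elim _ _
  tight_vert _ k := k.elim0
  nonneg_vert _ k := k.elim0
  opposite_pos _ _ k := k.elim0
  bounded := Bornology.IsBounded.all _

end DeformedCube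

/-! ### The functionals `φ` and `φ'` -/

lemma isLinearMap_phi (d : ℕ) : IsLinearMap ℝ (phi d) := by
  match d with
  | 0 => exact (0 : (Fin 0 → ℝ) →ₗ[ℝ] ℝ).isLinear
  | 1 => exact (0 : (Fin 1 → ℝ) →ₗ[ℝ] ℝ).isLinear
  | d + 2 => exact ⟨fun _ _ => rfl, fun _ _ => rfl⟩

lemma phi'_add_two (d : ℕ) (x : Fin (d + 2) → ℝ) :
    phi' (d + 2) x = x (Fin.natAdd d 1) +
      (((numVert d : ℝ) - 1) / ((numVert (d + 2) : ℝ) - 1)) ^ 2 *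
        phi' d (DeformedCube.initial d x) := by
  match d with
  | 0 => simp [phi']
  | d + 1 => rw [phi']; rfl

lemma isLinearMap_phi' (d : ℕ) : IsLinearMap ℝ (phi' d) := by
  match d with
  | 0 => exact (0 : (Fin 0 → ℝ) →ₗ[ℝ] ℝ).isLinear
  | 1 => exact (0 : (Fin 1 → ℝ) →ₗ[ℝ] ℝ).isLinear
  | d + 2 =>
    have ih := isLinearMap_phi' d
    constructor
    · intro x y
      simp only [phi'_add_two, map_add, ih.map_add, Pi.add_apply]
      ring
    · intro a x
      simp only [phi'_add_two, map_smul, ih.map_smul, Pi.smul_apply, smul_eq_mul]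
      ring

/-- `φ_d` as a linear functional. -/
def phiLin (d : ℕ) : (Fin d → ℝ) →ₗ[ℝ] ℝ := (isLinearMap_phi d).mk' _

/-- `φ'_d` as a linear functional. -/
def phiLin' (d : ℕ) : (Fin d → ℝ) →ₗ[ℝ] ℝ := (isLinearMap_phi' d).mk' _

@[simp] lemma phiLin_apply (d : ℕ) (x : Fin d → ℝ) : phiLin d x = phi d x := rfl

@[simp] lemma phiLin'_apply (d : ℕ) (x : Fin d → ℝ) : phiLin' d x = phi' d x := rfl

lemma phi_add_two (d : ℕ) (x : Fin (d + 2) → ℝ) : phi (d + 2) x = x (Fin.natAdd d 0) := rfl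

lemma numVert_two_mul (r : ℕ) : numVert (2 * r) = 2 ^ (2 * r) := by
  rw [numVert, Nat.mul_div_cancel_left r two_pos, pow_mul]; norm_num

/-! ### Rationality and the shadow -/

/-- An affine function on `ℝⁿ` with rational coefficients. -/
def IsRatAffine {n : ℕ} (g : (Fin n → ℝ) → ℝ) : Prop :=
  ∃ (a : Fin n → ℚ) (q : ℚ), ∀ x, g x = ∑ i, (a i : ℝ) * x i + q

namespace IsRatAffine

variable {n : ℕ} {g h : (Fin n → ℝ) → ℝ}

lemma const (q : ℚ) : IsRatAffine fun _ : Fin n → ℝ => (q : ℝ) := ⟨0, q, by simp⟩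

lemma proj (i : Fin n) : IsRatAffine fun x : Fin n → ℝ => x i :=
  ⟨Pi.single i 1, 0, fun x => by
    rw [Finset.sum_eq_single i] <;> simp +contextual [Pi.single_eq_of_ne]⟩

lemma add (hg : IsRatAffine g) (hh : IsRatAffine h) : IsRatAffine fun x => g x + h x := by
  obtain ⟨a, q, hg⟩ := hg
  obtain ⟨a', q', hh⟩ := hh
  refine ⟨a + a', q + q', fun x => ?_⟩
  simp only [hg, hh, Pi.add_apply, Rat.cast_add, add_mul, Finset.sum_add_distrib]
  ring

lemma const_mul (c : ℚ) (hg : IsRatAffine g) : IsRatAffine fun x => (c : ℝ) * g x := by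
  obtain ⟨a, q, hg⟩ := hg
  refine ⟨c • a, c * q, fun x => ?_⟩
  simp [hg, mul_add, Finset.mul_sum, mul_assoc]

lemma comp_initial {g : (Fin n → ℝ) → ℝ} (hg : IsRatAffine g) :
    IsRatAffine fun x => g (DeformedCube.initial n x) := by
  obtain ⟨a, q, hg⟩ := hg
  refine ⟨Fin.append a 0, q, fun x => ?_⟩
  simp [hg, Fin.sum_univ_add, DeformedCube.initial_apply]

lemma congr (hg : IsRatAffine g) (hgh : ∀ x, h x = g x) : IsRatAffine h :=
  (funext hgh : h = g) ▸ hg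

end IsRatAffine

lemma isRatAffine_phi (d : ℕ) : IsRatAffine (phi d) := by
  match d with
  | 0 => exact (IsRatAffine.const 0).congr fun _ => by simp [phi]
  | 1 => exact (IsRatAffine.const 0).congr fun _ => by simp [phi]
  | d + 2 => exact (IsRatAffine.proj (Fin.natAdd d 0)).congr fun _ => rfl

lemma isRatAffine_trapezoidSlack {n : ℕ} (M : ℕ) {s x y : (Fin n → ℝ) → ℝ}
    (hs : IsRatAffine s) (hx : IsRatAffine x) (hy : IsRatAffine y) (j : Fin 2) (b : Bool) :
    IsRatAffine fun p => trapezoidSlack M ((M - 1) * s p) (x p) (y p) j b := by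
  have h : ∀ α β γ δ : ℚ, IsRatAffine fun p => α * y p + β * x p + γ * s p + δ := fun α β γ δ =>
    (((hy.const_mul α).add (hx.const_mul β)).add (hs.const_mul γ)).add (IsRatAffine.const δ)
  fin_cases j <;> cases b
  · exact (h ((4 * M - 1) ^ 2) (2 * M * (4 * M - 1)) (M * (M - 1)) 0).congr fun p => by
      simp [trapezoidSlack]; ring
  · exact (h ((4 * M - 1) ^ 2) (-(2 * M * (4 * M - 1))) (M * (M - 1))
      (2 * M * (4 * M - 1))).congr fun p => by simp [trapezoidSlack]; ring
  · exact (h ((4 * M - 1) ^ 2) 0 (-(M * (M - 1))) (2 * M * (2 * M - 1))).congr fun p => by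
      simp [trapezoidSlack]; ring
  · exact (h (-(4 * M - 1) ^ 2) 0 (-(3 * M * (M - 1))) 0).congr fun p => by
      simp [trapezoidSlack]; ring

namespace DeformedCube

variable {d : ℕ}

/-- The constraints of `C` are rational, and the vertices of `C` project onto the points
`x^{(0)}, …, x^{(M - 1)}` of the parabola. -/
structure HasParabolaShadow (C : DeformedCube d) : Prop where
  isRatAffine : ∀ k b, IsRatAffine (C.slack k b)
  shadow_vert : ∀ σ, ∃ t < numVert d, shadowProj d (C.vert σ) = shadowVertex d t
  exists_vert : ∀ t < numVert d, ∃ σ, shadowProj d (C.vert σ) = shadowVertex d t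

lemma exists_rational (C : DeformedCube d) (hC : C.HasParabolaShadow) :
    ∃ (A : Matrix (Fin (2 * d)) (Fin d) ℚ) (b : Fin (2 * d) → ℚ),
      C.polytope = polyhedron (A.map fun q => (q : ℝ)) (fun i => (b i : ℝ)) := by
  choose a q h using hC.isRatAffine
  have e : Fin (2 * d) ≃ Fin d × Bool := Fintype.equivOfCardEq (by simp [mul_comm])
  refine ⟨Matrix.of fun i j => -a (e i).1 (e i).2 j, fun i => q (e i).1 (e i).2, ?_⟩
  have key : ∀ x i, Matrix.mulVec ((Matrix.of fun i j => -a (e i).1 (e i).2 j).map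
      fun q : ℚ => (q : ℝ)) x i ≤ (q (e i).1 (e i).2 : ℝ) ↔
        0 ≤ C.slack (e i).1 (e i).2 x := fun x i => by
    rw [h]
    simp [Matrix.mulVec, dotProduct]
    constructor <;> intro h <;> linarith
  ext x
  refine ⟨fun hx i => (key x i).2 (hx _ _), fun hx k b => ?_⟩
  simpa using (key x (e.symm (k, b))).1 (hx (e.symm (k, b)))

lemma phi_of_shadow {x : Fin d → ℝ} {t : ℕ} (h : shadowProj d x = shadowVertex d t) :
    phi d x = t / (numVert d - 1) ∧
      phi' d x = (t / (numVert d - 1)) ^ 2 - t / (numVert d - 1) :=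
  ⟨by simpa [shadowProj, shadowVertex, parabolaPt] using congrFun h 0,
    by simpa [shadowProj, shadowVertex, parabolaPt] using congrFun h 1⟩

lemma numVert_pos (d : ℕ) : 1 ≤ numVert d := Nat.one_le_pow _ _ (by norm_num)

lemma numVert_add_two (d : ℕ) : numVert (d + 2) = 4 * numVert d := by
  rw [numVert, numVert, Nat.add_div_right _ two_pos, pow_succ, mul_comm]

lemma HasParabolaShadow.phi_mem {C : DeformedCube d} (hC : C.HasParabolaShadow) :
    ∀ x ∈ C.polytope, 0 ≤ phiLin d x ∧ phiLin d x ≤ 1 := by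
  have hconv : Convex ℝ {x | 0 ≤ phiLin d x ∧ phiLin d x ≤ 1} :=
    (convex_halfSpace_ge (phiLin d).isLinear 0).inter (convex_halfSpace_le (phiLin d).isLinear 1)
  intro x hx
  rw [← convexHull_range_vert] at hx
  refine convexHull_min ?_ hconv hx
  rintro _ ⟨σ, rfl⟩
  obtain ⟨t, ht, hs⟩ := hC.shadow_vert σ
  have ht' : (t : ℝ) + 1 ≤ numVert d := by exact_mod_cast ht
  have ht0 : (0 : ℝ) ≤ t := t.cast_nonneg
  change 0 ≤ phi d _ ∧ phi d _ ≤ 1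
  rw [(phi_of_shadow hs).1]
  exact ⟨div_nonneg ht0 (by linarith), div_le_one_of_le₀ (by linarith) (by linarith)⟩

/-- Over the `t`-th vertex, the four corners project to the vertices with the numbers
`t`, `2 M - 1 - t`, `2 M + t` and `4 M - 1 - t`. -/
lemma shadow_append {x : Fin d → ℝ} {t s : ℕ} (ht : t < numVert d)
    (hx : shadowProj d x = shadowVertex d t) (h v : Bool)
    (hs : (s : ℝ) = cornerX (numVert d) t h v) :
    shadowProj (d + 2) (Fin.append x (corner (numVert d) (cornerLabel h v) (phi d x))) =
      shadowVertex (d + 2) s := by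
  obtain ⟨h1, h2⟩ := phi_of_shadow hx
  have hM := numVert_pos d
  have hM' : (1 : ℝ) ≤ numVert d := by exact_mod_cast hM
  have hD : 4 * (numVert d : ℝ) - 1 ≠ 0 := by linarith
  -- for `M = 1`, both sides vanish since `t = 0`
  have ht1 : ((numVert d : ℝ) - 1) * phi d x = t := by
    rw [h1]
    rcases eq_or_ne ((numVert d : ℝ) - 1) 0 with h0 | h0
    · have : numVert d = 1 := by exact_mod_cast sub_eq_zero.1 h0
      have : t = 0 := by omega
      simp [h0, this]
    · field_simp
  have ht2 : ((numVert d : ℝ) - 1) ^ 2 * phi' d x = t ^ 2 - t * (numVert d - 1) := by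
    rw [h2, ← h1, ← ht1]; ring
  have hX := mul_corner_zero hM (phi d x) h v
  have hY := mul_corner_one hM (phi d x) h v
  rw [ht1] at hX hY
  rw [← hs] at hX
  have hx' : corner (numVert d) (cornerLabel h v) (phi d x) 0 = s / (4 * numVert d - 1) := by
    rw [eq_div_iff hD, mul_comm, hX]
  simp only [shadowProj, shadowVertex, parabolaPt, phi_add_two, phi'_add_two, Fin.append_right,
    initial_append, numVert_add_two, Nat.cast_mul, Nat.cast_ofNat, hx']
  congr 2
  have hY' : corner (numVert d) (cornerLabel h v) (phi d x) 1 =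
      cornerY (numVert d) t v / (4 * numVert d - 1) ^ 2 := by
    rw [eq_div_iff (pow_ne_zero 2 hD), mul_comm, hY]
  rw [hY', div_pow, div_mul_eq_mul_div, ht2, hs]
  cases h <;> cases v <;> simp only [cornerX, cornerY] <;> field_simp <;> ring

/-- The deformed product keeps the shape of the shadow. -/
theorem HasParabolaShadow.extend {C : DeformedCube d} (hC : C.HasParabolaShadow) :
    (C.extend (numVert d) (numVert_pos d) (phiLin d) hC.phi_mem).HasParabolaShadow where
  isRatAffine k b := by
    refine Fin.addCases (fun k => ?_) (fun j => ?_) k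
    · exact (hC.isRatAffine k b).comp_initial.congr fun x => C.slack_extend_castAdd _ _ k b x
    · exact (isRatAffine_trapezoidSlack (numVert d) (isRatAffine_phi d).comp_initial
        (IsRatAffine.proj (Fin.natAdd d 0)) (IsRatAffine.proj (Fin.natAdd d 1)) j b).congr
          fun x => C.slack_extend_natAdd _ _ j b x
  shadow_vert σ := by
    obtain ⟨t, ht, hs⟩ := hC.shadow_vert fun k => σ (Fin.castAdd 2 k)
    have key := fun s => shadow_append (s := s) ht hs (σ (Fin.natAdd d 0)) (σ (Fin.natAdd d 1))
    rw [numVert_add_two]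
    change ∃ s < _, shadowProj (d + 2) (Fin.append _ _) = _
    generalize σ (Fin.natAdd d 0) = h at *
    generalize σ (Fin.natAdd d 1) = v at *
    cases h <;> cases v
    · refine ⟨2 * numVert d - 1 - t, by omega, key _ ?_⟩
      rw [Nat.cast_sub (by omega), Nat.cast_sub (by omega)]
      simp [cornerX]
    · exact ⟨t, by omega, key _ rfl⟩
    · exact ⟨2 * numVert d + t, by omega, key _ (by simp [cornerX])⟩
    · refine ⟨4 * numVert d - 1 - t, by omega, key _ ?_⟩
      rw [Nat.cast_sub (by omega), Nat.cast_sub (by omega)]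
      simp [cornerX]
  exists_vert s hs := by
    rw [numVert_add_two] at hs
    obtain ⟨t, ht, h, v, hst⟩ : ∃ t < numVert d, ∃ h v,
        (s : ℝ) = cornerX (numVert d) t h v := by
      rcases lt_or_ge s (numVert d) with h1 | h1
      · exact ⟨s, h1, false, true, rfl⟩
      rcases lt_or_ge s (2 * numVert d) with h2 | h2
      · refine ⟨2 * numVert d - 1 - s, by omega, false, false, ?_⟩
        rw [Nat.cast_sub (by omega), Nat.cast_sub (by omega)]
        simp [cornerX]
      rcases lt_or_ge s (3 * numVert d) with h3 | h3
      · refine ⟨s - 2 * numVert d, by omega, true, false, ?_⟩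
        rw [Nat.cast_sub (by omega)]
        simp [cornerX]
      · refine ⟨4 * numVert d - 1 - s, by omega, true, true, ?_⟩
        rw [Nat.cast_sub (by omega), Nat.cast_sub (by omega)]
        simp [cornerX]
    obtain ⟨σ, hσ⟩ := hC.exists_vert t ht
    refine ⟨Fin.append σ ![h, v], ?_⟩
    rw [vert_extend]
    exact shadow_append ht hσ h v hst

lemma hasParabolaShadow_point : point.HasParabolaShadow where
  isRatAffine k := k.elim0
  shadow_vert _ := ⟨0, by simp [numVert], by
    simp [shadowProj, shadowVertex, parabolaPt, phi, phi']⟩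
  exists_vert t ht := ⟨fun k => k.elim0, by
    obtain rfl : t = 0 := by simpa [numVert] using ht
    simp [shadowProj, shadowVertex, parabolaPt, phi, phi']⟩

lemma extPolytope_two : extPolytope 2 = (point.extend (numVert 0) (numVert_pos 0) (phiLin 0)
    hasParabolaShadow_point.phi_mem).polytope := by
  have happ : ∀ (x : Fin 0 → ℝ) (z : Fin 2 → ℝ), Fin.append x z = z := fun x z => by
    funext i; fin_cases i <;> rfl
  have hc : ∀ p σ, corner (numVert 0) p (phiLin 0 (point.vert σ)) = vertV 1 4 p := fun p σ => by
    have h0 : phiLin 0 (point.vert σ) = 0 := rfl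
    simp [corner, h0, numVert]
  have h00 : vertV 1 4 (0, 0) = vertV 2 2 (0, 0) := by simp [vertV]
  have h01 : vertV 1 4 (0, 1) = vertW 2 2 (0, 0) := by simp [vertV, vertW]; norm_num
  have h10 : vertV 1 4 (1, 0) = vertW 2 2 (0, 1) := by simp [vertV, vertW]; norm_num
  have h11 : vertV 1 4 (1, 1) = vertV 2 2 (0, 1) := by simp [vertV]; norm_num
  rw [← convexHull_range_vert, range_vert_extend, extPolytope]
  congr 1
  ext z
  constructor
  · rintro (⟨⟨i, l⟩, rfl⟩ | ⟨⟨i, l⟩, rfl⟩) <;> obtain rfl : i = 0 := Subsingleton.elim (α := Fin 1) _ _ <;>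
      fin_cases l
    · exact ⟨fun k => k.elim0, (0, 0), by rw [happ, hc]; exact h00.symm⟩
    · exact ⟨fun k => k.elim0, (1, 1), by rw [happ, hc]; exact h11.symm⟩
    · exact ⟨fun k => k.elim0, (0, 1), by rw [happ, hc]; exact h01.symm⟩
    · exact ⟨fun k => k.elim0, (1, 0), by rw [happ, hc]; exact h10.symm⟩
  · rintro ⟨σ, ⟨j, l⟩, rfl⟩
    rw [happ, hc]
    fin_cases j <;> fin_cases l
    · exact Or.inl ⟨(0, 0), h00.symm⟩
    · exact Or.inr ⟨(0, 0), h01.symm⟩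
    · exact Or.inr ⟨(0, 1), h10.symm⟩
    · exact Or.inl ⟨(0, 1), h11.symm⟩

/-- The polytopes `Q_d` are deformed cubes whose vertices project onto the parabola. -/
theorem exists_polytope_eq_extPolytope (r : ℕ) : ∃ C : DeformedCube (2 * (r + 1)),
    C.HasParabolaShadow ∧ C.polytope = extPolytope (2 * (r + 1)) := by
  induction r with
  | zero => exact ⟨_, hasParabolaShadow_point.extend, extPolytope_two.symm⟩
  | succ r ih =>
    obtain ⟨C, hC, heq⟩ := ih
    refine ⟨C.extend _ _ _ hC.phi_mem, hC.extend, ?_⟩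
    rw [polytope_extend, heq]
    rfl

end DeformedCube

/-! ### The objective -/

lemma objective_eq (d : ℕ) (x : Fin d → ℝ) : objective d x =
    phiLin d x ^ 2 - (1 - 3 / (2 * (numVert d : ℝ) - 2)) * phiLin d x - phiLin' d x := by
  simp [objective, shadowProj]

lemma convexOn_objective (d : ℕ) : ConvexOn ℝ univ (objective d) := by
  have h1 : ConvexOn ℝ univ fun x => phiLin d x ^ 2 :=
    (even_two.convexOn_pow (𝕜 := ℝ)).comp_linearMap (phiLin d)
  have h2 : ConvexOn ℝ univ
      ((-((1 - 3 / (2 * (numVert d : ℝ) - 2)) • phiLin d) - phiLin' d : _ →ₗ[ℝ] ℝ) : _ → ℝ) :=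
    LinearMap.convexOn _ convex_univ
  refine (h1.add h2).congr fun x _ => ?_
  rw [objective_eq]
  simp
  ring

lemma fderiv_objective (d : ℕ) (x v : Fin d → ℝ) : fderiv ℝ (objective d) x v =
    (2 * phi d x - (1 - 3 / (2 * (numVert d : ℝ) - 2))) * phi d v - phi' d v := by
  have h1 : HasFDerivAt (fun x => phiLin d x) (phiLin d).toContinuousLinearMap x :=
    (phiLin d).toContinuousLinearMap.hasFDerivAt
  have h2 : HasFDerivAt (fun x => phiLin' d x) (phiLin' d).toContinuousLinearMap x :=
    (phiLin' d).toContinuousLinearMap.hasFDerivAt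
  have h := ((h1.pow 2).sub (h1.const_mul (1 - 3 / (2 * (numVert d : ℝ) - 2)))).sub h2
  have hobj : objective d = ((fun x => phiLin d x ^ 2) -
      fun x => (1 - 3 / (2 * (numVert d : ℝ) - 2)) * phiLin d x) - fun x => phiLin' d x :=
    funext (objective_eq d)
  rw [hobj, h.fderiv]
  simp
  ring

/-- The gradient is monotone along every ray, by convexity. -/
lemma fderiv_objective_le (d : ℕ) (x v : Fin d → ℝ) {μ : ℝ} (hμ : 0 ≤ μ) :
    fderiv ℝ (objective d) x v ≤ fderiv ℝ (objective d) (x + μ • v) v := by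
  rw [fderiv_objective, fderiv_objective, (isLinearMap_phi d).map_add,
    (isLinearMap_phi d).map_smul, smul_eq_mul]
  have := mul_nonneg hμ (mul_self_nonneg (phi d v))
  linarith

lemma objective_of_shadow {d t : ℕ} {x : Fin d → ℝ} (h : shadowProj d x = shadowVertex d t) :
    objective d x = 3 / (2 * (numVert d : ℝ) - 2) * (t / (numVert d - 1)) := by
  obtain ⟨h1, h2⟩ := DeformedCube.phi_of_shadow h
  rw [objective_eq, phiLin_apply, phiLin'_apply, h1, h2]
  ring

/-- The directional derivative is positive from the `t`-th vertex towards the `(t + 1)`-st vertex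
and towards no other. -/
lemma fderiv_objective_pos_iff {d t s : ℕ} (hd : 1 < numVert d) {x y : Fin d → ℝ}
    (hx : shadowProj d x = shadowVertex d t) (hy : shadowProj d y = shadowVertex d s) :
    0 < fderiv ℝ (objective d) x (y - x) ↔ s = t + 1 := by
  obtain ⟨hx1, hx2⟩ := DeformedCube.phi_of_shadow hx
  obtain ⟨hy1, hy2⟩ := DeformedCube.phi_of_shadow hy
  have hM : (0 : ℝ) < numVert d - 1 := by
    rw [sub_pos]; exact_mod_cast hd
  have hM' : 2 * (numVert d : ℝ) - 2 ≠ 0 := by linarith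
  have key : fderiv ℝ (objective d) x (y - x) =
      ((s : ℝ) - t) * (t - s + 3 / 2) / (numVert d - 1) ^ 2 := by
    rw [fderiv_objective, (isLinearMap_phi d).map_sub, (isLinearMap_phi' d).map_sub,
      hx1, hx2, hy1, hy2, show 2 * (numVert d : ℝ) - 2 = 2 * (numVert d - 1) by ring]
    field_simp
    ring
  rw [key, div_pos_iff_of_pos_right (by positivity)]
  constructor
  · intro h
    rcases lt_trichotomy s (t + 1) with hs | hs | hs
    · have : (s : ℝ) ≤ t := by exact_mod_cast Nat.lt_succ_iff.1 hs
      nlinarith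
    · exact hs
    · have : (t : ℝ) + 2 ≤ s := by exact_mod_cast hs
      nlinarith
  · rintro rfl
    push_cast
    norm_num

/-! ### The path through all vertices -/

namespace DeformedCube

variable {d : ℕ} {C : DeformedCube d}

/-- The vertices in the order of their shadows along the parabola. -/
structure IsShadowOrder (C : DeformedCube d) (σ : ℕ → Fin d → Bool) : Prop where
  bijOn : BijOn σ (Iio (numVert d)) univ
  shadow : ∀ t < numVert d, shadowProj d (C.vert (σ t)) = shadowVertex d t

lemma eq_of_shadow {x : Fin d → ℝ} {s t : ℕ} (hd : 1 < numVert d)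
    (hs : shadowProj d x = shadowVertex d s) (ht : shadowProj d x = shadowVertex d t) : s = t := by
  have h1 := (phi_of_shadow hs).1
  rw [(phi_of_shadow ht).1] at h1
  have hM : (numVert d : ℝ) - 1 ≠ 0 := by
    rw [sub_ne_zero]; exact_mod_cast hd.ne'
  rw [div_left_inj' hM] at h1
  exact_mod_cast h1.symm

lemma HasParabolaShadow.exists_order (hC : C.HasParabolaShadow) (hd : 1 < numVert d)
    (hcard : numVert d = 2 ^ d) : ∃ σ, C.IsShadowOrder σ := by
  have h := hC.exists_vert
  choose! σ hσ using h
  have hinj : InjOn σ (Iio (numVert d)) := fun s hs t ht hst =>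
    eq_of_shadow hd (hσ s hs) (hst ▸ hσ t ht)
  refine ⟨σ, ⟨mapsTo_univ _ _, hinj, ?_⟩, hσ⟩
  refine (eq_of_subset_of_ncard_le (subset_univ _) ?_).ge
  rw [hinj.ncard_image, ncard_univ, ← Finset.coe_Iio, ncard_coe_finset]
  simp [hcard]

namespace IsShadowOrder

variable {σ : ℕ → Fin d → Bool}

lemma exists_eq (hσ : C.IsShadowOrder σ) (τ : Fin d → Bool) : ∃ t < numVert d, σ t = τ :=
  hσ.bijOn.surjOn (mem_univ τ)

lemma fderiv_pos_iff (hσ : C.IsShadowOrder σ) (hd : 1 < numVert d) {s t : ℕ}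
    (ht : t < numVert d) (hs : s < numVert d) :
    0 < fderiv ℝ (objective d) (C.vert (σ t)) (C.vert (σ s) - C.vert (σ t)) ↔ s = t + 1 :=
  fderiv_objective_pos_iff hd (hσ.shadow t ht) (hσ.shadow s hs)

/-- Since the next vertex is the only one that is better to first order, it is adjacent to the
current one, and the edge to it is the only improving one. -/
lemma exists_uniqueImproving (hσ : C.IsShadowOrder σ) (hd : 1 < numVert d) {t : ℕ}
    (ht : t + 1 < numVert d) :
    ∃ k, flip (σ t) k = σ (t + 1) ∧ C.UniqueImproving (objective d) (σ t) k := by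
  have ht0 : t < numVert d := by omega
  have hflip : ∀ j, 0 < fderiv ℝ (objective d) (C.vert (σ t))
      (C.vert (flip (σ t) j) - C.vert (σ t)) ↔ flip (σ t) j = σ (t + 1) := fun j => by
    obtain ⟨s, hs, hsj⟩ := hσ.exists_eq (flip (σ t) j)
    rw [← hsj, hσ.fderiv_pos_iff hd ht0 hs]
    exact (hσ.bijOn.injOn.eq_iff hs ht).symm
  obtain ⟨k, -, hk⟩ := C.exists_edge_pos (σ := σ t) (v := C.vert (σ (t + 1)) - C.vert (σ t))
    (g := (fderiv ℝ (objective d) (C.vert (σ t))).toLinearMap)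
    (fun k => by rw [lin_sub, slack_vert, sub_zero]; exact C.vert_mem _ _ _)
    ((hσ.fderiv_pos_iff hd ht0 ht).2 rfl)
  have hk' := (hflip k).1 hk
  exact ⟨k, hk', fun j => (hflip j).trans ⟨fun h => flip_injective _ (h.trans hk'.symm),
    fun h => h ▸ hk'⟩⟩

lemma isMaxOn_last (hσ : C.IsShadowOrder σ) (hd : 1 < numVert d) {t : ℕ}
    (ht : t + 1 = numVert d) : IsMaxOn (objective d) C.polytope (C.vert (σ t)) := by
  intro x hx
  rw [← convexHull_range_vert] at hx
  obtain ⟨_, ⟨τ, rfl⟩, hle⟩ := ((convexOn_objective d).subset (subset_univ _)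
    (convex_convexHull ℝ _)).exists_ge_of_mem_convexHull (subset_convexHull ℝ _) hx
  refine hle.trans ?_
  obtain ⟨s, hs, rfl⟩ := hσ.exists_eq τ
  rw [objective_of_shadow (hσ.shadow s hs), objective_of_shadow (hσ.shadow t (by omega))]
  have hM : (1 : ℝ) < numVert d := by exact_mod_cast hd
  have hst : (s : ℝ) ≤ t := by exact_mod_cast (by omega : s ≤ t)
  have h1 : 0 ≤ 3 / (2 * (numVert d : ℝ) - 2) := div_nonneg (by norm_num) (by linarith)
  exact mul_le_mul_of_nonneg_left (div_le_div_of_nonneg_right hst (by linarith)) h1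

lemma existsUnique_improvingEdge (hσ : C.IsShadowOrder σ) (hd : 1 < numVert d) {x : Fin d → ℝ}
    (hx : x ∈ C.polytope.extremePoints ℝ) (hmax : ¬ IsMaxOn (objective d) C.polytope x) :
    ∃! F, IsImprovingEdge (objective d) C.polytope x F := by
  rw [extremePoints_polytope] at hx
  obtain ⟨τ, rfl⟩ := hx
  obtain ⟨t, ht, rfl⟩ := hσ.exists_eq τ
  have ht1 : t + 1 ≠ numVert d := fun h => hmax (hσ.isMaxOn_last hd h)
  obtain ⟨k, -, hk⟩ := hσ.exists_uniqueImproving hd (by omega : t + 1 < numVert d)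
  exact hk.existsUnique

lemma eq_vert_zero (hσ : C.IsShadowOrder σ) (hd : 1 < numVert d) {x : Fin d → ℝ}
    (hx : x ∈ C.polytope.extremePoints ℝ) (h : shadowProj d x = shadowVertex d 0) :
    x = C.vert (σ 0) := by
  rw [extremePoints_polytope] at hx
  obtain ⟨τ, rfl⟩ := hx
  obtain ⟨t, ht, rfl⟩ := hσ.exists_eq τ
  rw [eq_of_shadow hd (hσ.shadow t ht) h]

variable {m : ℕ} {A : Matrix (Fin m) (Fin d) ℝ} {b : Fin m → ℝ}
  {π : Fin d × Bool ≃ Fin m} {c : Fin d × Bool → ℝ}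

open ActiveSet

lemma step_iff (hσ : C.IsShadowOrder σ) (hd : 1 < numVert d) (D : C.Describes A b π c) {t : ℕ}
    (ht : t + 1 < numVert d) (s : State m d) :
    Step (objective d) A b ⟨C.vert (σ t), tight A b (C.vert (σ t))⟩ s ↔
      s = ⟨C.vert (σ (t + 1)), tight A b (C.vert (σ (t + 1)))⟩ := by
  obtain ⟨k, hflip, hk⟩ := hσ.exists_uniqueImproving hd ht
  rw [D.step_iff hk (fun v μ hμ => fderiv_objective_le d _ v hμ) s, hflip]

lemma halts_iff (hσ : C.IsShadowOrder σ) (hd : 1 < numVert d) (D : C.Describes A b π c) {t : ℕ}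
    (ht : t < numVert d) (S : Finset (Fin m)) :
    Halts (objective d) A b ⟨C.vert (σ t), S⟩ ↔ t + 1 = numVert d := by
  constructor
  · intro h
    by_contra hne
    obtain ⟨v, hv, -⟩ := (hσ.step_iff hd D (by omega : t + 1 < numVert d) _).2 rfl
    exact (h : improvingDirections _ _ _ _ = ∅).not_gt ⟨empty_subset _, fun h' => h' hv⟩
  · intro h
    refine D.halts (fun j => not_lt.1 fun hpos => ?_) S
    obtain ⟨s, hs, hsj⟩ := hσ.exists_eq (flip (σ t) j)
    rw [← hsj, hσ.fderiv_pos_iff hd ht hs] at hpos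
    omega

/-- Every execution follows the vertices in the order of their shadows. -/
lemma isRun_eq (hσ : C.IsShadowOrder σ) (hd : 1 < numVert d) (D : C.Describes A b π c)
    {T : ℕ} {s : ℕ → State m d} (h : IsRun (objective d) A b (C.vert (σ 0)) T s) :
    ∀ t ≤ T, t < numVert d ∧ s t = ⟨C.vert (σ t), tight A b (C.vert (σ t))⟩ := by
  intro t
  induction t with
  | zero => exact fun _ => ⟨by omega, h.1⟩
  | succ t ih =>
    intro ht
    obtain ⟨h1, h2⟩ := ih (by omega)
    have hstep := h.2 t ht
    rw [h2] at hstep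
    have h3 : t + 1 < numVert d := by
      by_contra hge
      obtain ⟨v, hv, -⟩ := hstep
      have hhalt := (hσ.halts_iff hd D h1 (tight A b (C.vert (σ t)))).2 (by omega)
      rw [show improvingDirections _ _ _ _ = ∅ from hhalt] at hv
      exact hv
    exact ⟨h3, (hσ.step_iff hd D h3 _).1 hstep⟩

end IsShadowOrder

end DeformedCube

end

/-- For every even `d ≥ 2`, the polytope `P = Q_d ⊆ ℝ^d` has `2 d` facets and `2 ^ d` vertices,
every non-optimal vertex has a unique improving edge for the convex quadratic objective `f`, and
for every description of `P` by one inequality per facet, every execution of the active-set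
method from the unique vertex projecting to `x^{(0)} = (0, 0)`, whatever the pivot choices, takes
exactly `2 ^ d` iterations (the last of which detects termination), following the improving edges
through all vertices of `P`, the `t`-th of which projects to `x^{(t)}`. -/
theorem theorem3p8 (d : ℕ) (hd : Even d) (hpos : 0 < d) :
    -- `P` is a polytope with `2 d` facets and `2 ^ d` vertices, with a rational description
    Bornology.IsBounded (extPolytope d) ∧
    {F | IsFacet (extPolytope d) F}.ncard = 2 * d ∧
    ((extPolytope d).extremePoints ℝ).ncard = 2 ^ d ∧
    (∃ (A : Matrix (Fin (2 * d)) (Fin d) ℚ) (b : Fin (2 * d) → ℚ),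
      extPolytope d = polyhedron (A.map fun q => (q : ℝ)) (fun i => (b i : ℝ))) ∧
    -- the objective is convex
    ConvexOn ℝ Set.univ (objective d) ∧
    -- unique improving edge at every non-optimal vertex
    (∀ x ∈ (extPolytope d).extremePoints ℝ, ¬ IsMaxOn (objective d) (extPolytope d) x →
      ∃! F, IsImprovingEdge (objective d) (extPolytope d) x F) ∧
    -- the starting vertex is well-defined
    shadowVertex d 0 = ![0, 0] ∧
    (∃! x, x ∈ (extPolytope d).extremePoints ℝ ∧ shadowProj d x = shadowVertex d 0) ∧
    -- behaviour of the active-set method started there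
    ∀ x₀ ∈ (extPolytope d).extremePoints ℝ, shadowProj d x₀ = shadowVertex d 0 →
      ∀ (A : Matrix (Fin (2 * d)) (Fin d) ℝ) (b : Fin (2 * d) → ℝ),
        extPolytope d = polyhedron A b →
        -- no execution gets stuck or goes on for more than `2 ^ d` iterations
        (∀ (T : ℕ) (s : ℕ → ActiveSet.State (2 * d) d),
          ActiveSet.IsRun (objective d) A b x₀ T s →
            T + 1 ≤ 2 ^ d ∧
            (¬ ActiveSet.Halts (objective d) A b (s T) →
              ∃ σ, ActiveSet.Step (objective d) A b (s T) σ)) ∧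
        -- every finished execution has `2 ^ d` iterations, follows the improving edges,
        -- visits every vertex, and ends in an optimal vertex
        (∀ (T : ℕ) (s : ℕ → ActiveSet.State (2 * d) d),
          ActiveSet.IsCompleteRun (objective d) A b x₀ T s →
            T + 1 = 2 ^ d ∧
            (∀ t ≤ T, shadowProj d (s t).point = shadowVertex d t) ∧
            (∀ t < T, IsImprovingEdge (objective d) (extPolytope d) (s t).point
              (segment ℝ (s t).point (s (t + 1)).point)) ∧
            Set.BijOn (fun t => (s t).point) (Set.Iic T) ((extPolytope d).extremePoints ℝ) ∧
            IsMaxOn (objective d) (extPolytope d) (s T).point) := by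
  obtain ⟨r, rfl⟩ : ∃ r, d = 2 * (r + 1) := by
    obtain ⟨r, rfl⟩ := hd
    exact ⟨r - 1, by omega⟩
  obtain ⟨C, hC, hP⟩ := DeformedCube.exists_polytope_eq_extPolytope r
  have hcard : numVert (2 * (r + 1)) = 2 ^ (2 * (r + 1)) := numVert_two_mul (r + 1)
  generalize 2 * (r + 1) = d at *
  have hM : 1 < numVert d := hcard ▸ Nat.one_lt_two_pow hpos.ne'
  obtain ⟨σ, hσ⟩ := hC.exists_order hM hcard
  have h0 : C.vert (σ 0) ∈ C.polytope.extremePoints ℝ := by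
    rw [C.extremePoints_polytope]; exact Set.mem_range_self _
  rw [← hP]
  refine ⟨C.bounded, C.ncard_facets, C.ncard_extremePoints, C.exists_rational hC,
    convexOn_objective d, fun x hx hmax => hσ.existsUnique_improvingEdge hM hx hmax,
    by simp [shadowVertex, parabolaPt],
    ⟨C.vert (σ 0), ⟨h0, hσ.shadow 0 (by omega)⟩, fun x hx => hσ.eq_vert_zero hM hx.1 hx.2⟩, ?_⟩
  intro x₀ hx₀ hshadow A b hAb
  obtain rfl := hσ.eq_vert_zero hM hx₀ hshadow
  obtain ⟨π, c, D⟩ := C.exists_describes hAb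
  rw [← hcard]
  refine ⟨fun T s hrun => ?_, fun T s hrun => ?_⟩
  · obtain ⟨hT, hs⟩ := hσ.isRun_eq hM D hrun T le_rfl
    refine ⟨hT, fun hhalt => ?_⟩
    rw [hs, hσ.halts_iff hM D hT] at hhalt
    rw [hs]
    exact ⟨_, (hσ.step_iff hM D (by omega) _).2 rfl⟩
  · have hs := hσ.isRun_eq hM D hrun.1
    have hT : T + 1 = numVert d := by
      have hhalt := hrun.2
      rwa [(hs T le_rfl).2, hσ.halts_iff hM D (hs T le_rfl).1] at hhalt
    refine ⟨hT, fun t ht => ?_, fun t ht => ?_, ?_, ?_⟩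
    · rw [(hs t ht).2]
      exact hσ.shadow t (hs t ht).1
    · rw [(hs t ht.le).2, (hs (t + 1) ht).2]
      obtain ⟨k, hflip, hk⟩ := hσ.exists_uniqueImproving hM (hs (t + 1) ht).1
      rw [← hflip]
      exact ⟨C.isEdge_segment _ _, left_mem_segment ℝ _ _, _, right_mem_segment ℝ _ _,
        (hk k).2 rfl⟩
    · have hIic : Set.Iic T = Set.Iio (numVert d) := by ext t; simp; omega
      rw [C.extremePoints_polytope, ← Set.image_univ]
      have h := (C.vert_injective.injOn (s := Set.univ)).bijOn_image.comp hσ.bijOn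
      rw [← hIic] at h
      exact h.congr fun t ht => by rw [Function.comp_apply, (hs t ht).2]
    · rw [(hs T le_rfl).2]
      exact hσ.isMaxOn_last hM hT
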